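/- Let $n\ge 1$ and let $\gamma_{-1}$ be the inverse Gaussian measure on $\mathbb{R}^n$, with Lebesgue density $\pi^{n/2}e^{|x|^2}$. For $k=(k_1,\dots,k_n)\in\mathbb{N}^n$ (with $0\in\mathbb{N}$) put $|k|=k_1+\dots+k_n$ and $\widetilde H_k(x)=e^{-|x|^2}\prod_{i=1}^n H_{k_i}(x_i)$, where $H_m(z)=(-1)^m e^{z^2}\frac{d^m}{dz^m}e^{-z^2}$; these functions are eigenfunctions, with eigenvalues $|k|+n$, of the closure $\mathcal{A}$ in $L^2(\mathbb{R}^n,\gamma_{-1})$ of the operator $-\frac12\Delta-x\cdot\nabla$ on $C_c^\infty(\mathbb{R}^n)$. For $\beta>0$ the negative power $\mathcal{A}^{-\beta}$ is the operator on $L^2(\mathbb{R}^n,\gamma_{-1})$ given by $$\mathcal{A}^{-\beta}f=\sum_{k\in\mathbb{N}^n}\frac{c_k(f)}{(|k|+n)^{\beta}}\,\widetilde H_k,\qquad c_k(f)=\frac{\pi^{n/2}}{\|\widetilde H_k\|_{L^2(\mathbb{R}^n,\gamma_{-1})}^2}\int_{\mathbb{R}^n}f(y)\widetilde H_k(y)e^{|y|^2}\,dy,$$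 where the series converges (unconditionally) in $L^2(\mathbb{R}^n,\gamma_{-1})$. Then, for every $\beta>0$: (i) for every $1<p<\infty$, $\mathcal{A}^{-\beta}$ can be extended from $L^p(\mathbb{R}^n,\gamma_{-1})\cap L^2(\mathbb{R}^n,\gamma_{-1})$ to $L^p(\mathbb{R}^n,\gamma_{-1})$ as a bounded linear operator from $L^p(\mathbb{R}^n,\gamma_{-1})$ into itself; (ii) $\mathcal{A}^{-\beta}$ can be extended from $L^1(\mathbb{R}^n,\gamma_{-1})\cap L^2(\mathbb{R}^n,\gamma_{-1})$ to $L^1(\mathbb{R}^n,\gamma_{-1})$ as a bounded linear operator from $L^1(\mathbb{R}^n,\gamma_{-1})$ into $L^{1,\infty}(\mathbb{R}^n,\gamma_{-1})$; that is, there are a linear extension $T$ and a constant $C$ with $\gamma_{-1}(\{x:|Tf(x)|>s\})\le \frac{C}{s}\|f\|_{L^1(\mathbb{R}^n,\gamma_{-1})}$ for all $f\in L^1(\mathbb{R}^n,\gamma_{-1})$ and $s>0$. -/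

import Mathlib

open MeasureTheory
open scoped ENNReal NNReal

namespace InverseGauss

noncomputable section

/-- The inverse Gaussian measure `γ₋₁` on `ℝⁿ`, with Lebesgue density `π^(n/2) e^{|x|²}`. -/
def gammaInv (n : ℕ) : Measure (EuclideanSpace ℝ (Fin n)) :=
  volume.withDensity fun x => ENNReal.ofReal (Real.pi ^ ((n : ℝ) / 2) * Real.exp (‖x‖ ^ 2))

/-- The one-dimensional Hermite polynomial `H_m(z) = (-1)^m e^{z²} (d/dz)^m e^{-z²}`. -/
def hermite1 (m : ℕ) (z : ℝ) : ℝ :=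
  (-1) ^ m * Real.exp (z ^ 2) * iteratedDeriv m (fun w : ℝ => Real.exp (-w ^ 2)) z

/-- The `n`-dimensional Hermite polynomial `H_k(x) = ∏ᵢ H_{kᵢ}(xᵢ)`. -/
def hermiteN {n : ℕ} (k : Fin n → ℕ) (x : EuclideanSpace ℝ (Fin n)) : ℝ :=
  ∏ i, hermite1 (k i) (x i)

/-- The function `e^{-|x|²} H_k(x)`. -/
def hermiteTilde {n : ℕ} (k : Fin n → ℕ) (x : EuclideanSpace ℝ (Fin n)) : ℝ :=
  Real.exp (-‖x‖ ^ 2) * hermiteN k x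

theorem hermite1_eq_poly (m : ℕ) : ∃ P : Polynomial ℝ, ∀ z, hermite1 m z = P.eval z := by
  have key : ∃ P : Polynomial ℝ, iteratedDeriv m (fun w : ℝ => Real.exp (-w ^ 2)) =
      fun z => P.eval z * Real.exp (-z ^ 2) := by
    induction m with
    | zero => exact ⟨1, by ext z; simp⟩
    | succ m ih =>
      obtain ⟨P, hP⟩ := ih
      refine ⟨Polynomial.derivative P - 2 * Polynomial.X * P, ?_⟩
      rw [iteratedDeriv_succ, hP]
      ext z
      have h1 : HasDerivAt (fun z : ℝ => Real.exp (-z ^ 2))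
          (Real.exp (-z ^ 2) * (-(2 * z))) z := by
        have h2 : HasDerivAt (fun z : ℝ => -z ^ 2) (-(2 * z)) z := by
          have h4 := (hasDerivAt_pow 2 z).fun_neg
          norm_num at h4
          exact h4
        exact h2.exp
      have h3 := ((P.hasDerivAt z).mul h1).deriv
      refine Eq.trans h3 ?_
      simp
      ring
  obtain ⟨P, hP⟩ := key
  refine ⟨Polynomial.C ((-1) ^ m) * P, fun z => ?_⟩
  have h : Real.exp (z ^ 2) * Real.exp (-z ^ 2) = 1 := by
    rw [← Real.exp_add]; simp
  rw [hermite1, hP, Polynomial.eval_mul, Polynomial.eval_C]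
  linear_combination (-1) ^ m * P.eval z * h

theorem integrable_poly_mul_gaussian (P : Polynomial ℝ) :
    Integrable fun z : ℝ => P.eval z * Real.exp (-z ^ 2) := by
  induction P using Polynomial.induction_on' with
  | add p q hp hq =>
    refine (hp.add hq).congr (Filter.Eventually.of_forall fun z => ?_)
    simp [add_mul]
  | monomial m a =>
    have h := (integrable_rpow_mul_exp_neg_mul_sq (b := 1) one_pos
      (s := m) (by linarith [(Nat.cast_nonneg m : (0 : ℝ) ≤ m)])).const_mul a
    simpa [mul_assoc] using h

theorem continuous_hermiteTilde {n : ℕ} (k : Fin n → ℕ) : Continuous (hermiteTilde k) := by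
  have h : ∀ m, Continuous (hermite1 m) := fun m => by
    obtain ⟨P, hP⟩ := hermite1_eq_poly m
    rw [funext hP]
    exact P.continuous
  unfold hermiteTilde hermiteN
  refine Continuous.mul (by fun_prop) (continuous_finsetProd _ fun i _ => ?_)
  exact (h _).comp (by fun_prop)

theorem integrable_hermiteTilde_sq {n : ℕ} (k : Fin n → ℕ) :
    Integrable (fun x => hermiteTilde k x ^ 2) (gammaInv n) := by
  have h1 : Integrable (fun x : Fin n → ℝ =>
      ∏ i, (hermite1 (k i) (x i) ^ 2 * Real.exp (-(x i) ^ 2))) volume := by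
    refine Integrable.fintype_prod (f := fun i z => hermite1 (k i) z ^ 2 * Real.exp (-z ^ 2))
      fun i => ?_
    obtain ⟨P, hP⟩ := hermite1_eq_poly (k i)
    refine (integrable_poly_mul_gaussian (P ^ 2)).congr (Filter.Eventually.of_forall fun z => ?_)
    simp only [hP, Polynomial.eval_pow]
  have h2 := ((PiLp.volume_preserving_ofLp (Fin n)).integrable_comp
    h1.aestronglyMeasurable).2 h1
  have h3 := h2.const_mul (Real.pi ^ ((n : ℝ) / 2))
  unfold gammaInv
  rw [integrable_withDensity_iff (by fun_prop) (by simp)]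
  refine h3.congr (Filter.Eventually.of_forall fun x => ?_)
  have hpos : 0 ≤ Real.pi ^ ((n : ℝ) / 2) * Real.exp (‖x‖ ^ 2) := by positivity
  have hn : ∏ i, Real.exp (-(x i) ^ 2) = Real.exp (-‖x‖ ^ 2) := by
    rw [← Real.exp_sum, EuclideanSpace.real_norm_sq_eq]
    simp
  have hc : Real.exp (-‖x‖ ^ 2) * Real.exp (‖x‖ ^ 2) = 1 := by
    rw [← Real.exp_add]; simp
  simp only [Function.comp_apply, hermiteTilde, hermiteN, ENNReal.toReal_ofReal hpos,
    Finset.prod_mul_distrib, hn, Finset.prod_pow]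
  linear_combination (-(Real.pi ^ ((n : ℝ) / 2)) * Real.exp (-‖x‖ ^ 2) *
    (∏ i, hermite1 (k i) (x i)) ^ 2) * hc

variable (𝕜 : Type*) [RCLike 𝕜] {n : ℕ}

theorem memLp_hermiteTilde (k : Fin n → ℕ) :
    MemLp (fun x => ((hermiteTilde k x : ℝ) : 𝕜)) 2 (gammaInv n) :=
  ((memLp_two_iff_integrable_sq (continuous_hermiteTilde k).aestronglyMeasurable).2
    (integrable_hermiteTilde_sq k)).ofReal

/-- The function `e^{-|x|²} H_k(x)` as an element of `L²(γ₋₁)`. -/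
def hermiteL2 (k : Fin n → ℕ) : Lp 𝕜 2 (gammaInv n) :=
  (memLp_hermiteTilde 𝕜 k).toLp _

variable {𝕜}

/-- The coefficient `c_k(f) = π^(n/2) ‖H̃_k‖⁻² ∫ f(y) H̃_k(y) e^{|y|²} dy`, where
`H̃_k(y) = e^{-|y|²} H_k(y)` and the norm is that of `L²(γ₋₁)`. -/
def coeff (f : Lp 𝕜 2 (gammaInv n)) (k : Fin n → ℕ) : 𝕜 :=
  ((Real.pi ^ ((n : ℝ) / 2) / ‖hermiteL2 𝕜 k‖ ^ 2 : ℝ) : 𝕜) *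
    ∫ y, f y * ((hermiteTilde k y * Real.exp (‖y‖ ^ 2) : ℝ) : 𝕜)

/-- The `k`-th term `c_k(f) (|k| + n)^{-β} H̃_k` of the series that defines `𝒜^{-β} f`. -/
def negPowTerm (β : ℝ) (f : Lp 𝕜 2 (gammaInv n)) (k : Fin n → ℕ) : Lp 𝕜 2 (gammaInv n) :=
  (coeff f k / (((((∑ i, k i : ℕ) : ℝ) + n) ^ β : ℝ) : 𝕜)) • hermiteL2 𝕜 k

/-- The negative power `𝒜^{-β} f = ∑_k c_k(f) (|k| + n)^{-β} H̃_k` on `L²(γ₋₁)`; the (unordered)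
series is taken in the norm of `L²(γ₋₁)`. -/
def negPow (β : ℝ) (f : Lp 𝕜 2 (gammaInv n)) : Lp 𝕜 2 (gammaInv n) :=
  ∑' k : Fin n → ℕ, negPowTerm β f k

end

end InverseGauss

namespace InverseGauss

noncomputable section

open Real Set

variable {n : ℕ}

local notation "E" n => EuclideanSpace ℝ (Fin n)

/-! Formally 𝒜^{-β} = Γ(β)⁻¹ ∫₀^∞ t^{β-1} e^{-t𝒜} dt, and e^{-t𝒜} has an explicit positive symmetric
kernel against γ₋₁, Mehler's kernel with r = e^{-t}. Integrating it in t gives one pointwise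
formula, `riesz`, behind all the extensions. It is dominated by its positive companion `potential`,
for which all estimates are made.

Strong type: the kernel has mass one, so constants show no decay in t; but it maps e^{-a|x|²}, 0 < a
≤ 1, to at most a^{-n/2} e^{-nt} times itself. After integration in t, e^{-b|x|²} is thus an
admissible weight for the Schur test `lintegral_rpow_le_of_schur` once bp, bq ≤ 1.

Weak type: times t ≤ 1 preserve the L¹ norm of nonnegative functions and carry finite total weight,
so Markov's inequality suffices. For t > 1 the kernel is at most e^{-nt} e^{-|x|²} e^{-|y -
e^{-t}x|²}, and t^{β-1} costs a factor e^{t/2}. For x = ρω the substitution u = e^{-t}ρ leaves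
ρ^{-(n-1/2)} e^{-ρ²} V(ω); by `lintegral_sublevel_le` its superlevel set on each ray has mass at
most a constant times V(ω)/s. The spherical integral of V is ∫ |z|^{-1/2} G(z) dz, where G is a
Gaussian convolution of Fγ₋₁, and this is bounded by the L¹ norm of F.

Identification: the H̃_k are eigenfunctions of the kernel with eigenvalue r^{|k|+n} and form a
complete orthogonal system. By the strong bound with p = 2, `riesz` is continuous on L², so it may
be applied term by term to the Hermite expansion; this gives the series for 𝒜^{-β} together with its
convergence (`hasSum_negPowTerm`). -/

theorem pi_rpow_half (n : ℕ) : π ^ ((n : ℝ) / 2) = √π ^ n := by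
  rw [sqrt_eq_rpow, ← rpow_mul_natCast pi_pos.le]
  congr 1; ring

/-! ### Mehler's kernel and its action on Gaussians -/

/-- The kernel with respect to `γ₋₁` of the semigroup generated by `-𝒜` at the time `-log r`. -/
def mehler (r : ℝ) (x y : E n) : ℝ :=
  (π ^ n)⁻¹ * (r / √(1 - r ^ 2)) ^ n *
    exp (-(‖x‖ ^ 2 + ‖y‖ ^ 2 - 2 * r * inner ℝ x y) / (1 - r ^ 2))

theorem mehler_comm (r : ℝ) (x y : E n) : mehler r x y = mehler r y x := by
  unfold mehler
  rw [real_inner_comm, add_comm (‖x‖ ^ 2)]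

theorem mehler_nonneg {r : ℝ} (hr : 0 ≤ r) (x y : E n) : 0 ≤ mehler r x y := by
  unfold mehler; positivity

theorem measurable_mehler :
    Measurable fun z : ℝ × (E n) × (E n) => mehler z.1 z.2.1 z.2.2 := by
  unfold mehler; fun_prop

/-- The kernel of the semigroup generated by `-𝒜` as a function with values in `[0, ∞]`. -/
def mehlerE (t : ℝ) (x y : E n) : ℝ≥0∞ := ENNReal.ofReal (mehler (exp (-t)) x y)

theorem mehlerE_comm (t : ℝ) (x y : E n) : mehlerE t x y = mehlerE t y x := by
  rw [mehlerE, mehler_comm, mehlerE]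

theorem measurable_mehlerE :
    Measurable fun z : ℝ × (E n) × (E n) => mehlerE z.1 z.2.1 z.2.2 := by
  have h : Measurable fun z : ℝ × (E n) × (E n) => (exp (-z.1), z.2) := by fun_prop
  exact (measurable_mehler.comp h).ennreal_ofReal

theorem measurable_mehlerE_comp {α : Type*} [MeasurableSpace α] {f : α → ℝ} {g h : α → E n}
    (hf : Measurable f) (hg : Measurable g) (hh : Measurable h) :
    Measurable fun a => mehlerE (f a) (g a) (h a) :=
  (measurable_mehlerE (n := n)).comp (f := fun a => (f a, g a, h a)) (hf.prodMk (hg.prodMk hh))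

instance : SigmaFinite (gammaInv n) := by
  unfold gammaInv
  exact SigmaFinite.withDensity_of_ne_top (by simp)

theorem lintegral_gammaInv (F : (E n) → ℝ≥0∞) :
    ∫⁻ y, F y ∂(gammaInv n) =
      ∫⁻ y, ENNReal.ofReal (√π ^ n * exp (‖y‖ ^ 2)) * F y := by
  unfold gammaInv
  rw [lintegral_withDensity_eq_lintegral_mul_non_measurable _ (by fun_prop) (by simp)]
  simp [pi_rpow_half]

theorem lintegral_exp_neg_mul_sq_norm_sub {b : ℝ} (hb : 0 < b) (w : E n) :
    ∫⁻ y, ENNReal.ofReal (exp (-b * ‖y - w‖ ^ 2)) = ENNReal.ofReal (√(π / b) ^ n) := by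
  rw [lintegral_sub_right_eq_self (fun y : E n => ENNReal.ofReal (exp (-b * ‖y‖ ^ 2))) w]
  have h0 := GaussianFourier.integral_rexp_neg_mul_sq_norm (V := E n) hb
  have h1 : Integrable fun y : E n => exp (-b * ‖y‖ ^ 2) := by
    -- The Bochner integral of a non-integrable function is zero, so a positive value already forces
    -- integrability.
    by_contra h
    rw [integral_undef h] at h0
    have : 0 < (π / b) ^ (Module.finrank ℝ (E n) / 2 : ℝ) := by positivity
    exact this.ne h0
  rw [← ofReal_integral_eq_lintegral_ofReal h1 (Filter.Eventually.of_forall fun y => by positivity),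
    h0, sqrt_eq_rpow, ← rpow_mul_natCast (by positivity)]
  congr 2
  simp; ring

/-- Complete the square in y: with the density e^{|y|²} included, the integrand is a Gaussian of
rate d/(1 - r²) centred at (r/d)x, where d = r² + a(1 - r²), times e^{-a|x|²/d}. -/
theorem lintegral_mehler_mul_gaussian {r a : ℝ} (hr0 : 0 < r) (hr1 : r < 1) (ha0 : 0 ≤ a)
    (x : E n) :
    ∫⁻ y, ENNReal.ofReal (mehler r x y) * ENNReal.ofReal (exp (-a * ‖y‖ ^ 2)) ∂(gammaInv n) =
      ENNReal.ofReal ((r / √(r ^ 2 + a * (1 - r ^ 2))) ^ n *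
        exp (-a / (r ^ 2 + a * (1 - r ^ 2)) * ‖x‖ ^ 2)) := by
  have hr2 : 0 < 1 - r ^ 2 := by nlinarith
  set d := r ^ 2 + a * (1 - r ^ 2) with hd
  have hd0 : 0 < d := by positivity
  have hb : 0 < d / (1 - r ^ 2) := by positivity
  have key : ∀ y : E n, ENNReal.ofReal (√π ^ n * exp (‖y‖ ^ 2)) *
      (ENNReal.ofReal (mehler r x y) * ENNReal.ofReal (exp (-a * ‖y‖ ^ 2))) =
      ENNReal.ofReal (√π ^ n * ((π ^ n)⁻¹ * (r / √(1 - r ^ 2)) ^ n) *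
        exp (-a / d * ‖x‖ ^ 2)) *
        ENNReal.ofReal (exp (-(d / (1 - r ^ 2)) * ‖y - (r / d) • x‖ ^ 2)) := by
    intro y
    rw [← ENNReal.ofReal_mul (mehler_nonneg hr0.le _ _), ← ENNReal.ofReal_mul (by positivity),
      ← ENNReal.ofReal_mul (by positivity)]
    congr 1
    have h : ‖y - (r / d) • x‖ ^ 2 = ‖y‖ ^ 2 - 2 * (r / d) * inner ℝ x y +
        (r / d) ^ 2 * ‖x‖ ^ 2 := by
      rw [norm_sub_sq_real, inner_smul_right, norm_smul, mul_pow, real_inner_comm x y]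
      simp only [norm_eq_abs, sq_abs]; ring
    have he : exp (‖y‖ ^ 2) * (exp (-(‖x‖ ^ 2 + ‖y‖ ^ 2 - 2 * r * inner ℝ x y) / (1 - r ^ 2)) *
        exp (-a * ‖y‖ ^ 2)) = exp (-a / d * ‖x‖ ^ 2) *
          exp (-(d / (1 - r ^ 2)) * ‖y - (r / d) • x‖ ^ 2) := by
      rw [← exp_add, ← exp_add, ← exp_add, h]
      congr 1
      field_simp
      rw [hd]; ring
    unfold mehler
    linear_combination (√π ^ n * ((π ^ n)⁻¹ * (r / √(1 - r ^ 2)) ^ n)) * he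
  rw [lintegral_gammaInv]
  simp_rw [key]
  rw [lintegral_const_mul _ (by fun_prop), lintegral_exp_neg_mul_sq_norm_sub hb,
    ← ENNReal.ofReal_mul (by positivity)]
  congr 1
  have hs : √(π / (d / (1 - r ^ 2))) = √π * √(1 - r ^ 2) / √d := by
    rw [← sqrt_mul pi_pos.le, ← sqrt_div (by positivity)]
    congr 1; field_simp
  have hpi : √π * √π = π := mul_self_sqrt pi_pos.le
  have h1 : (π ^ n)⁻¹ = (√π⁻¹) ^ n * (√π⁻¹) ^ n := by
    rw [← mul_pow, ← inv_pow, sqrt_inv, ← mul_inv, hpi]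
  have h2 : √π * (√π⁻¹ * √π⁻¹ * (r / √(1 - r ^ 2))) * (√π * √(1 - r ^ 2) / √d) = r / √d := by
    have := sqrt_pos.2 pi_pos
    have := sqrt_pos.2 hr2
    have := sqrt_pos.2 hd0
    rw [sqrt_inv]
    field_simp
  rw [hs, h1, ← h2]
  simp only [mul_pow]; ring

theorem exp_neg_lt_one {t : ℝ} (ht : 0 < t) : exp (-t) < 1 := by simpa using ht

theorem lintegral_mehlerE {t : ℝ} (ht : 0 < t) (x : E n) :
    ∫⁻ y, mehlerE t x y ∂(gammaInv n) = 1 := by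
  have h := lintegral_mehler_mul_gaussian (exp_pos (-t)) (exp_neg_lt_one ht) le_rfl x
  have h2 : √(exp (-t) ^ 2) = exp (-t) := sqrt_sq (exp_pos _).le
  simpa [mehlerE, h2] using h

/-- Here a ≤ d ≤ 1, so d^{-n/2} ≤ a^{-n/2} and a/d ≥ a; the remaining factor r^n is the decay
e^{-nt}. -/
theorem lintegral_mehlerE_mul_gaussian_le {t a : ℝ} (ht : 0 < t) (ha0 : 0 < a) (ha1 : a ≤ 1)
    (x : E n) :
    ∫⁻ y, mehlerE t x y * ENNReal.ofReal (exp (-a * ‖y‖ ^ 2)) ∂(gammaInv n) ≤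
      ENNReal.ofReal ((√a ^ n)⁻¹ * exp (-n * t)) * ENNReal.ofReal (exp (-a * ‖x‖ ^ 2)) := by
  refine (lintegral_mehler_mul_gaussian (exp_pos (-t)) (exp_neg_lt_one ht) ha0.le x).trans_le ?_
  rw [← ENNReal.ofReal_mul (by positivity)]
  apply ENNReal.ofReal_le_ofReal
  set r := exp (-t) with hr
  have hr0 : 0 < r := exp_pos _
  have hr1 : r < 1 := exp_neg_lt_one ht
  have hr2 : 0 < 1 - r ^ 2 := by nlinarith
  have h1 : a ≤ r ^ 2 + a * (1 - r ^ 2) := by nlinarith [sq_nonneg r]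
  have h2 : r ^ 2 + a * (1 - r ^ 2) ≤ 1 := by nlinarith [sq_nonneg r]
  have h3 : exp (-n * t) = r ^ n := by rw [hr, ← exp_nat_mul]; congr 1; ring
  rw [h3, ← inv_pow, ← mul_pow, inv_mul_eq_div]
  have hsa : 0 < √a := sqrt_pos.2 ha0
  gcongr
  rw [neg_div, neg_le_neg_iff]
  exact le_div_self ha0.le (by linarith) h2

/-! ### Integration in time -/

/-- The measure `t^(β-1) / Γ(β) dt` on `(0, ∞)`. -/
def riemannLiouville (β : ℝ) : Measure ℝ :=
  (volume.restrict (Ioi 0)).withDensity fun t => ENNReal.ofReal (t ^ (β - 1) / Gamma β)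

instance (β : ℝ) : SigmaFinite (riemannLiouville β) := by
  unfold riemannLiouville
  exact SigmaFinite.withDensity_of_ne_top (by simp)

theorem lintegral_riemannLiouville (β : ℝ) (F : ℝ → ℝ≥0∞) :
    ∫⁻ t, F t ∂(riemannLiouville β) =
      ∫⁻ t in Ioi 0, ENNReal.ofReal (t ^ (β - 1) / Gamma β) * F t := by
  unfold riemannLiouville
  rw [lintegral_withDensity_eq_lintegral_mul_non_measurable _ (by fun_prop) (by simp)]
  simp

theorem ae_pos_riemannLiouville (β : ℝ) : ∀ᵐ t ∂(riemannLiouville β), 0 < t := by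
  unfold riemannLiouville
  exact (withDensity_absolutelyContinuous _ _).ae_le (ae_restrict_mem measurableSet_Ioi)

theorem integral_exp_riemannLiouville {β c : ℝ} (hβ : 0 < β) (hc : 0 < c) :
    ∫ t, exp (-c * t) ∂(riemannLiouville β) = (c ^ β)⁻¹ := by
  unfold riemannLiouville
  rw [integral_withDensity_eq_integral_toReal_smul (by fun_prop) (by simp)]
  have hG := Gamma_pos_of_pos hβ
  have h : ∀ t ∈ Ioi (0 : ℝ), (ENNReal.ofReal (t ^ (β - 1) / Gamma β)).toReal • exp (-c * t) =
      (Gamma β)⁻¹ * (t ^ (β - 1) * exp (-(c * t))) := by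
    intro t ht
    have : (0 : ℝ) < t := ht
    rw [ENNReal.toReal_ofReal (by positivity), smul_eq_mul, neg_mul]; ring
  rw [setIntegral_congr_fun measurableSet_Ioi h, integral_const_mul,
    integral_rpow_mul_exp_neg_mul_Ioi hβ hc, one_div, inv_rpow hc.le]
  field_simp

theorem lintegral_exp_riemannLiouville {β c : ℝ} (hβ : 0 < β) (hc : 0 < c) :
    ∫⁻ t, ENNReal.ofReal (exp (-c * t)) ∂(riemannLiouville β) = ENNReal.ofReal (c ^ β)⁻¹ := by
  have h0 := integral_exp_riemannLiouville hβ hc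
  have h1 : Integrable (fun t => exp (-c * t)) (riemannLiouville β) := by
    by_contra h
    rw [integral_undef h] at h0
    have : 0 < (c ^ β)⁻¹ := by positivity
    exact this.ne h0
  rw [← h0, ofReal_integral_eq_lintegral_ofReal h1 (Filter.Eventually.of_forall fun y => by positivity)]

/-- The indicator of t ≤ 1 is at most e · e^{-t}, whose integral is known. -/
theorem riemannLiouville_Iic_one_lt_top {β : ℝ} (hβ : 0 < β) :
    riemannLiouville β (Iic 1) < ∞ := by
  have h : riemannLiouville β (Iic 1) ≤
      ∫⁻ t, ENNReal.ofReal (exp 1) * ENNReal.ofReal (exp (-1 * t)) ∂(riemannLiouville β) := by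
    rw [← lintegral_indicator_one measurableSet_Iic]
    refine lintegral_mono fun t => ?_
    by_cases ht : t ∈ Iic (1 : ℝ)
    · rw [indicator_of_mem ht, ← ENNReal.ofReal_mul (by positivity), ← exp_add]
      simp only [Pi.one_apply, ENNReal.one_le_ofReal]
      apply one_le_exp
      have : t ≤ 1 := ht
      linarith
    · simp [indicator_of_notMem ht]
  rw [lintegral_const_mul _ (by fun_prop), lintegral_exp_riemannLiouville hβ one_pos] at h
  exact h.trans_lt (ENNReal.mul_lt_top ENNReal.ofReal_lt_top ENNReal.ofReal_lt_top)

/-! ### The Schur test and the strong bound -/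

/-- The Schur test for a positive kernel that is symmetric in the two space variables. -/
theorem lintegral_rpow_le_of_schur {X T : Type*} [MeasurableSpace X] [MeasurableSpace T]
    {γ : Measure X} {ν : Measure T} [SigmaFinite γ] [SigmaFinite ν] {κ : T → X → X → ℝ≥0∞}
    (hκ : Measurable fun z : T × X × X => κ z.1 z.2.1 z.2.2)
    (hsymm : ∀ t x y, κ t x y = κ t y x) {p q : ℝ} (hpq : p.HolderConjugate q)
    {w : X → ℝ≥0∞} (hw : Measurable w) (hw0 : ∀ x, w x ≠ 0) (hwt : ∀ x, w x ≠ ∞) {C : ℝ≥0∞}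
    (hp : ∀ x, ∫⁻ z, κ z.1 x z.2 * w z.2 ^ p ∂(ν.prod γ) ≤ C * w x ^ p)
    (hq : ∀ x, ∫⁻ z, κ z.1 x z.2 * w z.2 ^ q ∂(ν.prod γ) ≤ C * w x ^ q)
    {F : X → ℝ≥0∞} (hF : Measurable F) :
    ∫⁻ x, (∫⁻ z, κ z.1 x z.2 * F z.2 ∂(ν.prod γ)) ^ p ∂γ ≤ C ^ p * ∫⁻ x, F x ^ p ∂γ := by
  have hp0 := hpq.pos
  have hq0 := hpq.symm.pos
  have hκx : ∀ x, Measurable fun z : T × X => κ z.1 x z.2 := fun x =>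
    hκ.comp (f := fun z : T × X => (z.1, x, z.2)) (by fun_prop)
  have hκ' : Measurable fun z : (X × X) × T => κ z.2 z.1.1 z.1.2 :=
    hκ.comp (f := fun z : (X × X) × T => (z.2, z.1.1, z.1.2)) (by fun_prop)
  have hmul : ∀ x y, w x ^ p * (w x ^ (-p) * y) = y := fun x y => by
    rw [← mul_assoc, ← ENNReal.rpow_add _ _ (hw0 x) (hwt x)]; simp
  have hκt : ∀ x y, Measurable fun t => κ t x y := fun x y =>
    hκ.comp (f := fun t : T => (t, x, y)) (by fun_prop)
  -- Hölder for κF = (κ^{1/p} w⁻¹ F)(κ^{1/q} w): the hypothesis on w^q bounds the second factor and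
  -- produces C^{p-1} w(x)^p.
  have holder : ∀ x, (∫⁻ z, κ z.1 x z.2 * F z.2 ∂(ν.prod γ)) ^ p ≤
      C ^ (p - 1) * (w x ^ p *
        ∫⁻ z, κ z.1 x z.2 * (w z.2 ^ (-p) * F z.2 ^ p) ∂(ν.prod γ)) := by
    intro x
    have h := ENNReal.lintegral_mul_le_Lp_mul_Lq (ν.prod γ) hpq
      (f := fun z => κ z.1 x z.2 ^ (1 / p) * ((w z.2)⁻¹ * F z.2))
      (g := fun z => κ z.1 x z.2 ^ (1 / q) * w z.2)
      (by have := hκx x; fun_prop) (by have := hκx x; fun_prop)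
    have e1 : ∀ z : T × X, ((fun z : T × X => κ z.1 x z.2 ^ (1 / p) * ((w z.2)⁻¹ * F z.2)) *
        (fun z : T × X => κ z.1 x z.2 ^ (1 / q) * w z.2)) z = κ z.1 x z.2 * F z.2 := by
      intro z
      have h1 : κ z.1 x z.2 ^ (1 / p) * κ z.1 x z.2 ^ (1 / q) = κ z.1 x z.2 := by
        rw [← ENNReal.rpow_add_of_nonneg _ _ (by positivity) (by positivity)]
        simp [hpq.inv_add_inv_eq_one]
      have h2 : (w z.2)⁻¹ * w z.2 = 1 := ENNReal.inv_mul_cancel (hw0 _) (hwt _)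
      simp only [Pi.mul_apply]
      calc _ = (κ z.1 x z.2 ^ (1 / p) * κ z.1 x z.2 ^ (1 / q)) * ((w z.2)⁻¹ * w z.2) * F z.2 := by
            ring
        _ = _ := by rw [h1, h2, mul_one]
    have e2 : ∀ z : T × X, (κ z.1 x z.2 ^ (1 / p) * ((w z.2)⁻¹ * F z.2)) ^ p =
        κ z.1 x z.2 * (w z.2 ^ (-p) * F z.2 ^ p) := by
      intro z
      rw [ENNReal.mul_rpow_of_nonneg _ _ hp0.le, ENNReal.mul_rpow_of_nonneg _ _ hp0.le,
        ← ENNReal.rpow_mul, one_div, inv_mul_cancel₀ hp0.ne', ENNReal.rpow_one, ENNReal.inv_rpow,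
        ENNReal.rpow_neg]
    have e3 : ∀ z : T × X, (κ z.1 x z.2 ^ (1 / q) * w z.2) ^ q = κ z.1 x z.2 * w z.2 ^ q := by
      intro z
      rw [ENNReal.mul_rpow_of_nonneg _ _ hq0.le, ← ENNReal.rpow_mul, one_div,
        inv_mul_cancel₀ hq0.ne', ENNReal.rpow_one]
    rw [lintegral_congr e1, lintegral_congr e2, lintegral_congr e3] at h
    calc _ ≤ ((∫⁻ z, κ z.1 x z.2 * (w z.2 ^ (-p) * F z.2 ^ p) ∂(ν.prod γ)) ^ (1 / p) *
          (C * w x ^ q) ^ (1 / q)) ^ p := by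
            gcongr
            refine h.trans ?_
            gcongr
            exact hq x
      _ = _ := by
        have h1 : 1 / q * p = p - 1 := by
          rw [one_div_mul_eq_div, hpq.div_conj_eq_sub_one]
        have h2 : q * (p - 1) = p := by rw [mul_comm]; exact hpq.sub_one_mul_conj
        rw [ENNReal.mul_rpow_of_nonneg _ _ hp0.le, ← ENNReal.rpow_mul, one_div,
          inv_mul_cancel₀ hp0.ne', ENNReal.rpow_one, ← ENNReal.rpow_mul, h1,
          ENNReal.mul_rpow_of_nonneg _ _ hpq.sub_one_pos.le, ← ENNReal.rpow_mul, h2]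
        ring
  have hin : Measurable fun x => w x ^ p *
      ∫⁻ z, κ z.1 x z.2 * (w z.2 ^ (-p) * F z.2 ^ p) ∂(ν.prod γ) := by
    refine (hw.pow_const p).mul (Measurable.lintegral_prod_right'
      (f := fun a : X × (T × X) => κ a.2.1 a.1 a.2.2 * (w a.2.2 ^ (-p) * F a.2.2 ^ p)) ?_)
    have := hκ.comp (f := fun a : X × (T × X) => (a.2.1, a.1, a.2.2)) (by fun_prop)
    exact this.mul (by fun_prop)
  -- Tonelli and the symmetry of κ turn the x-integral into the hypothesis on w^p at y, whose w(y)^p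
  -- cancels w(y)^{-p}.
  have swap : ∫⁻ x, w x ^ p *
      ∫⁻ z, κ z.1 x z.2 * (w z.2 ^ (-p) * F z.2 ^ p) ∂(ν.prod γ) ∂γ ≤
        C * ∫⁻ y, F y ^ p ∂γ := by
    calc _ = ∫⁻ x, ∫⁻ y, w x ^ p * (w y ^ (-p) * F y ^ p) * ∫⁻ t, κ t x y ∂ν ∂γ ∂γ := by
          refine lintegral_congr fun x => ?_
          rw [lintegral_prod_symm _ (by have := hκx x; fun_prop),
            ← lintegral_const_mul _ (Measurable.lintegral_prod_right'
              (f := fun a : X × T => κ a.2 x a.1 * (w a.1 ^ (-p) * F a.1 ^ p)) (by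
                have := (hκx x).comp (measurable_swap (α := X) (β := T))
                exact this.mul (by fun_prop)))]
          refine lintegral_congr fun y => ?_
          simp only
          rw [lintegral_mul_const _ (hκt x y)]
          ring
      _ = ∫⁻ y, ∫⁻ x, w x ^ p * (w y ^ (-p) * F y ^ p) * ∫⁻ t, κ t x y ∂ν ∂γ ∂γ := by
          refine lintegral_lintegral_swap (Measurable.aemeasurable ?_)
          exact Measurable.mul (by fun_prop) (Measurable.lintegral_prod_right' hκ')
      _ = ∫⁻ y, (w y ^ (-p) * F y ^ p) *
            ∫⁻ z, κ z.1 y z.2 * w z.2 ^ p ∂(ν.prod γ) ∂γ := by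
          refine lintegral_congr fun y => ?_
          rw [lintegral_prod_symm _ (by have := hκx y; fun_prop),
            ← lintegral_const_mul _ (Measurable.lintegral_prod_right'
              (f := fun a : X × T => κ a.2 y a.1 * w a.1 ^ p) (by
                have := (hκx y).comp (measurable_swap (α := X) (β := T))
                exact this.mul (by fun_prop)))]
          refine lintegral_congr fun x => ?_
          simp only
          rw [lintegral_mul_const _ (hκt y x)]
          simp_rw [hsymm _ x y]
          ring
      _ ≤ ∫⁻ y, (w y ^ (-p) * F y ^ p) * (C * w y ^ p) ∂γ := by
          gcongr with y
          exact hp y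
      _ = ∫⁻ y, C * F y ^ p ∂γ := by
          refine lintegral_congr fun y => ?_
          conv_rhs => rw [← hmul y (F y ^ p)]
          ring
      _ = _ := lintegral_const_mul _ (by fun_prop)
  calc _ ≤ ∫⁻ x, C ^ (p - 1) * (w x ^ p *
        ∫⁻ z, κ z.1 x z.2 * (w z.2 ^ (-p) * F z.2 ^ p) ∂(ν.prod γ)) ∂γ := lintegral_mono holder
    _ ≤ C ^ (p - 1) * (C * ∫⁻ y, F y ^ p ∂γ) := by
      rw [lintegral_const_mul _ hin]
      gcongr
    _ = _ := by
      rw [← mul_assoc]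
      congr 1
      conv_lhs => rw [← ENNReal.rpow_one C, ← ENNReal.rpow_mul, one_mul]
      rw [← ENNReal.rpow_add_of_nonneg _ _ hpq.sub_one_pos.le zero_le_one, sub_add_cancel]

/-- The integral operator with the kernel `∫ t^(β-1) / Γ(β) e^{-t𝒜}(x, y) dt`, on functions with
values in `[0, ∞]`. -/
def potential (β : ℝ) (F : (E n) → ℝ≥0∞) (x : E n) : ℝ≥0∞ :=
  ∫⁻ z, mehlerE z.1 x z.2 * F z.2 ∂((riemannLiouville β).prod (gammaInv n))

theorem potential_gaussian_le {β a : ℝ} (hβ : 0 < β) (hn : 0 < n) (ha0 : 0 < a) (ha1 : a ≤ 1)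
    (x : E n) :
    potential β (fun y => ENNReal.ofReal (exp (-a * ‖y‖ ^ 2))) x ≤
      ENNReal.ofReal ((√a ^ n)⁻¹ * ((n : ℝ) ^ β)⁻¹) * ENNReal.ofReal (exp (-a * ‖x‖ ^ 2)) := by
  unfold potential
  have hm : Measurable fun z : ℝ × E n => mehlerE z.1 x z.2 :=
    measurable_mehlerE_comp measurable_fst measurable_const measurable_snd
  rw [lintegral_prod _ (by fun_prop)]
  calc _ ≤ ∫⁻ t, ENNReal.ofReal (√a ^ n)⁻¹ * ENNReal.ofReal (exp (-n * t)) *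
        ENNReal.ofReal (exp (-a * ‖x‖ ^ 2)) ∂(riemannLiouville β) := by
        refine lintegral_mono_ae ?_
        filter_upwards [ae_pos_riemannLiouville β] with t ht
        rw [← ENNReal.ofReal_mul (by positivity)]
        exact lintegral_mehlerE_mul_gaussian_le ht ha0 ha1 x
    _ = _ := by
      rw [lintegral_mul_const _ (by fun_prop), lintegral_const_mul _ (by fun_prop),
        lintegral_exp_riemannLiouville hβ (by exact_mod_cast hn), ENNReal.ofReal_mul (by positivity)]

theorem exists_lintegral_potential_rpow_le (hn : 0 < n) {β p : ℝ} (hβ : 0 < β) (hp : 1 < p) :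
    ∃ C : ℝ≥0, ∀ F : (E n) → ℝ≥0∞, Measurable F →
      ∫⁻ x, potential β F x ^ p ∂(gammaInv n) ≤ (C : ℝ≥0∞) ^ p * ∫⁻ x, F x ^ p ∂(gammaInv n) := by
  have hpq := Real.HolderConjugate.conjExponent hp
  set q := p.conjExponent
  have hp0 := hpq.pos
  have hq0 := hpq.symm.pos
  -- Only bp ≤ 1 and bq ≤ 1 are needed, so that both powers of the weight are Gaussians with
  -- admissible a.
  set b := 1 / (p + q) with hb
  have hb0 : 0 < b := by positivity
  have hbp : b * p ≤ 1 := by rw [hb, one_div_mul_eq_div, div_le_one (by positivity)]; linarith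
  have hbq : b * q ≤ 1 := by rw [hb, one_div_mul_eq_div, div_le_one (by positivity)]; linarith
  set C : ℝ≥0∞ := ENNReal.ofReal ((√(b * p) ^ n)⁻¹ * ((n : ℝ) ^ β)⁻¹) +
    ENNReal.ofReal ((√(b * q) ^ n)⁻¹ * ((n : ℝ) ^ β)⁻¹)
  have hCt : C ≠ ∞ := ENNReal.add_ne_top.2 ⟨ENNReal.ofReal_ne_top, ENNReal.ofReal_ne_top⟩
  have hw : ∀ (x : E n) (s : ℝ), 0 < s → ENNReal.ofReal (exp (-b * ‖x‖ ^ 2)) ^ s =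
      ENNReal.ofReal (exp (-(b * s) * ‖x‖ ^ 2)) := fun x s hs => by
    rw [ENNReal.ofReal_rpow_of_nonneg (exp_pos _).le hs.le, ← exp_mul]
    congr 2; ring
  refine ⟨C.toNNReal, fun F hF => ?_⟩
  rw [ENNReal.coe_toNNReal hCt]
  refine lintegral_rpow_le_of_schur (κ := mehlerE) measurable_mehlerE mehlerE_comm hpq
    (w := fun x => ENNReal.ofReal (exp (-b * ‖x‖ ^ 2))) (by fun_prop)
    (fun x => by simp [exp_pos]) (fun x => by simp) (fun x => ?_) (fun x => ?_) hF
  · simp_rw [hw _ p hp0]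
    refine (potential_gaussian_le hβ hn (by positivity) hbp x).trans ?_
    gcongr
    exact le_self_add
  · simp_rw [hw _ q hq0]
    refine (potential_gaussian_le hβ hn (by positivity) hbq x).trans ?_
    gcongr
    exact le_add_self

/-! ### Weak type: the estimate along rays -/

theorem lintegral_eq_lintegral_sphere (hn : 0 < n) {F : (E n) → ℝ≥0∞} (hF : Measurable F) :
    ∫⁻ x, F x = ∫⁻ ω : Metric.sphere (0 : E n) 1, (∫⁻ ρ in Ioi (0 : ℝ),
      ENNReal.ofReal (ρ ^ (n - 1)) * F (ρ • (ω : E n))) ∂((volume : Measure (E n)).toSphere) := by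
  have : Nonempty (Fin n) := ⟨⟨0, hn⟩⟩
  have hdim : Module.finrank ℝ (E n) = n := by simp
  have hmp := (volume : Measure (E n)).measurePreserving_homeomorphUnitSphereProd
  calc ∫⁻ x, F x = ∫⁻ x : ({(0)}ᶜ : Set (E n)), F x ∂(Measure.comap Subtype.val volume) := by
        rw [lintegral_subtype_comap (measurableSet_singleton _).compl,
          restrict_compl_singleton]
    _ = ∫⁻ x : ({(0)}ᶜ : Set (E n)), (fun z : Metric.sphere (0 : E n) 1 × Ioi (0 : ℝ) =>
          F ((z.2 : ℝ) • (z.1 : E n))) (homeomorphUnitSphereProd (E n) x)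
            ∂(Measure.comap Subtype.val volume) := by
        refine lintegral_congr fun x => ?_
        have hx : ‖(x : E n)‖ ≠ 0 := norm_ne_zero_iff.2 x.2
        simp [smul_smul, hx]
    _ = ∫⁻ z, F ((z.2 : ℝ) • (z.1 : E n)) ∂((volume : Measure (E n)).toSphere.prod
          (Measure.volumeIoiPow (n - 1))) := by
        rw [hdim] at hmp
        exact hmp.lintegral_comp (f := fun z : Metric.sphere (0 : E n) 1 × Ioi (0 : ℝ) =>
          F ((z.2 : ℝ) • (z.1 : E n))) (by fun_prop)
    _ = _ := by
        rw [lintegral_prod _ (by fun_prop)]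
        refine lintegral_congr fun ω => ?_
        rw [Measure.volumeIoiPow, lintegral_withDensity_eq_lintegral_mul _ (by fun_prop)
          (by fun_prop)]
        exact lintegral_subtype_comap (μ := volume) measurableSet_Ioi
          fun ρ : ℝ => ENNReal.ofReal (ρ ^ (n - 1)) * F (ρ • (ω : E n))

/-- The substitution u = e^{-t}ρ: the orbit of a point under dilations fills its ray, so ρ survives
only through the power ρ^{-α}. -/
theorem lintegral_exp_mul_comp_exp_smul (α : ℝ) {ρ : ℝ} (hρ : 0 < ρ) (G : ℝ → ℝ≥0∞) :
    ∫⁻ t, ENNReal.ofReal (exp (-α * t)) * G (exp (-t) * ρ) =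
      ENNReal.ofReal (ρ ^ (-α)) * ∫⁻ u in Ioi 0, ENNReal.ofReal (u ^ (α - 1)) * G u := by
  have himg : (fun t => exp (-t) * ρ) '' univ = Ioi 0 := by
    ext u
    simp only [image_univ, mem_range, mem_Ioi]
    constructor
    · rintro ⟨t, rfl⟩; positivity
    · intro hu
      refine ⟨-log (u / ρ), ?_⟩
      rw [neg_neg, exp_log (by positivity)]
      field_simp
  have hder : ∀ t ∈ (univ : Set ℝ), HasDerivWithinAt (fun t => exp (-t) * ρ)
      (exp (-t) * (-1) * ρ) univ t := fun t _ =>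
    (((hasDerivAt_neg t).exp).mul_const ρ).hasDerivWithinAt
  have hinj : InjOn (fun t => exp (-t) * ρ) univ := fun s _ t _ h => by
    have := mul_right_cancel₀ hρ.ne' h
    simpa using this
  have h := lintegral_image_eq_lintegral_abs_deriv_mul MeasurableSet.univ hder hinj
    (fun u => ENNReal.ofReal (u ^ (α - 1)) * G u)
  rw [himg] at h
  rw [h, setLIntegral_univ, ← lintegral_const_mul' _ _ (by simp)]
  refine lintegral_congr fun t => ?_
  rw [← mul_assoc, ← mul_assoc, ← ENNReal.ofReal_mul (by positivity),
    ← ENNReal.ofReal_mul (by positivity)]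
  congr 2
  rw [mul_neg_one, neg_mul, neg_mul, abs_neg, abs_of_pos (by positivity), mul_assoc (ρ ^ (-α))]
  have h1 : exp (-t) * ρ * (exp (-t) * ρ) ^ (α - 1) = exp (-α * t) * ρ ^ α := by
    nth_rewrite 1 [← rpow_one (exp (-t) * ρ)]
    rw [← rpow_add (by positivity), add_sub_cancel, mul_rpow (exp_pos _).le hρ.le, ← exp_mul]
    congr 2; ring
  rw [h1, rpow_neg hρ.le, neg_mul]
  have : 0 < ρ ^ α := by positivity
  field_simp

/-- For h(ρ) = ρ^α e^{ρ²} with α = n - 1/2, the integrand is at most 2h', because √ρ ≤ 2(α + 2ρ²).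
Since h is injective, the change of variables u = h(ρ) sends the sublevel set into [0, a]. -/
theorem lintegral_sublevel_le (hn : 0 < n) (a : ℝ≥0∞) :
    ∫⁻ ρ in Ioi (0 : ℝ), {ρ : ℝ | ENNReal.ofReal (ρ ^ ((n : ℝ) - 1 / 2) * exp (ρ ^ 2)) < a}.indicator
      (fun ρ => ENNReal.ofReal (ρ ^ (n - 1) * exp (ρ ^ 2))) ρ ≤ 2 * a := by
  have hn1 : (1 : ℝ) ≤ n := by exact_mod_cast hn
  set α : ℝ := (n : ℝ) - 1 / 2 with hα
  have hα0 : 1 / 2 ≤ α := by linarith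
  set h : ℝ → ℝ := fun ρ => ρ ^ α * exp (ρ ^ 2) with hh
  set h' : ℝ → ℝ := fun ρ => α * ρ ^ (α - 1) * exp (ρ ^ 2) + ρ ^ α * (exp (ρ ^ 2) * (2 * ρ))
  have hm : Measurable h := by fun_prop
  have hmeas : MeasurableSet {ρ : ℝ | ENNReal.ofReal (h ρ) < a} :=
    measurableSet_lt (by fun_prop) measurable_const
  set S : Set ℝ := {ρ : ℝ | ENNReal.ofReal (h ρ) < a} ∩ Ioi 0 with hS
  have hSm : MeasurableSet S := hmeas.inter measurableSet_Ioi
  have hder : ∀ ρ ∈ S, HasDerivWithinAt h (h' ρ) S ρ := by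
    rintro ρ ⟨-, hρ⟩
    have hρ : 0 < ρ := hρ
    have h1 := (hasDerivAt_rpow_const (p := α) (Or.inl hρ.ne')).mul ((hasDerivAt_pow 2 ρ).exp)
    simp only [Nat.cast_ofNat, Nat.add_one_sub_one, pow_one] at h1
    exact h1.hasDerivWithinAt
  have hinj : InjOn h S := by
    refine StrictMonoOn.injOn (f := h) (s := S) ?_
    rintro ρ ⟨-, hρ⟩ σ ⟨-, hσ⟩ hlt
    have hρ : 0 < ρ := hρ
    have hσ : 0 < σ := hσ
    have h1 : ρ ^ α < σ ^ α := rpow_lt_rpow hρ.le hlt (by linarith)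
    have h2 : exp (ρ ^ 2) < exp (σ ^ 2) := exp_lt_exp.2 (by nlinarith)
    simp only [hh]
    gcongr
  have hbound : ∀ ρ ∈ S, ENNReal.ofReal (ρ ^ (n - 1) * exp (ρ ^ 2)) ≤
      2 * (ENNReal.ofReal |h' ρ| * 1) := by
    rintro ρ ⟨-, hρ⟩
    have hρ : 0 < ρ := hρ
    rw [mul_one, ← ENNReal.ofReal_ofNat 2, ← ENNReal.ofReal_mul (by norm_num)]
    apply ENNReal.ofReal_le_ofReal
    refine le_trans ?_ (mul_le_mul_of_nonneg_left (le_abs_self _) (by norm_num))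
    have hs : 0 < √ρ := sqrt_pos.2 hρ
    have e1 : ρ ^ (n - 1) = ρ ^ (α - 1) * √ρ := by
      rw [sqrt_eq_rpow, ← rpow_add hρ, ← rpow_natCast, Nat.cast_sub (by omega)]
      congr 1; push_cast; ring
    have e2 : ρ ^ α = ρ ^ (α - 1) * ρ := by
      nth_rewrite 3 [← rpow_one ρ]
      rw [← rpow_add hρ]; congr 1; ring
    have hs2 : √ρ ^ 2 = ρ := sq_sqrt hρ.le
    have h3 : √ρ ≤ 2 * (α + 2 * ρ ^ 2) := by
      nlinarith [sq_nonneg (√ρ - 1), sq_nonneg (ρ - 1 / 2)]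
    have h4 : 0 ≤ ρ ^ (α - 1) * exp (ρ ^ 2) := by positivity
    calc ρ ^ (n - 1) * exp (ρ ^ 2) = ρ ^ (α - 1) * exp (ρ ^ 2) * √ρ := by rw [e1]; ring
      _ ≤ ρ ^ (α - 1) * exp (ρ ^ 2) * (2 * (α + 2 * ρ ^ 2)) := by gcongr
      _ = _ := by simp only [h', e2]; ring
  have himg : h '' S ⊆ {u : ℝ | 0 ≤ u ∧ ENNReal.ofReal u < a} := by
    rintro _ ⟨ρ, ⟨hρ, hρ0⟩, rfl⟩
    have hρ0 : 0 < ρ := hρ0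
    refine ⟨?_, hρ⟩
    simp only [hh]; positivity
  have hvol : volume {u : ℝ | 0 ≤ u ∧ ENNReal.ofReal u < a} ≤ a := by
    rcases eq_or_ne a ∞ with rfl | ha
    · exact le_top
    · calc _ ≤ volume (Icc 0 a.toReal) := by
            refine measure_mono fun u hu => ⟨hu.1, ?_⟩
            exact (ENNReal.ofReal_le_iff_le_toReal ha).1 hu.2.le
        _ = a := by simp [ha]
  calc _ = ∫⁻ ρ in S, ENNReal.ofReal (ρ ^ (n - 1) * exp (ρ ^ 2)) := by
        rw [lintegral_indicator hmeas, Measure.restrict_restrict hmeas]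
    _ ≤ ∫⁻ ρ in S, 2 * (ENNReal.ofReal |h' ρ| * 1) := setLIntegral_mono' hSm hbound
    _ = 2 * ∫⁻ u in h '' S, 1 := by
        rw [lintegral_const_mul' _ _ (by simp), lintegral_image_eq_lintegral_abs_deriv_mul hSm hder
          hinj]
    _ ≤ 2 * a := by
        gcongr
        rw [setLIntegral_one]
        exact (measure_mono himg).trans hvol

/-- On the ray through ω the function is ρ^{-α} e^{-ρ²} V(ω), so its superlevel set is a sublevel
set of ρ^α e^{ρ²}. Since u^{α-1} = u^{n-1} u^{-1/2}, the integral of V over the sphere is the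
right-hand integral in polar coordinates. -/
theorem gammaInv_superlevel_le (hn : 0 < n) {G : (E n) → ℝ≥0∞} (hG : Measurable G) {s : ℝ≥0∞}
    (hs0 : s ≠ 0) (hst : s ≠ ∞) :
    gammaInv n {x | s < ENNReal.ofReal (exp (-‖x‖ ^ 2)) *
      ∫⁻ t, ENNReal.ofReal (exp (-((n : ℝ) - 1 / 2) * t)) * G (exp (-t) • x)} ≤
    ENNReal.ofReal (√π ^ n) * 2 / s * ∫⁻ z, ENNReal.ofReal (‖z‖ ^ (-(1 / 2 : ℝ))) * G z := by
  set α : ℝ := (n : ℝ) - 1 / 2 with hα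
  set A : Set (E n) := {x | s < ENNReal.ofReal (exp (-‖x‖ ^ 2)) *
      ∫⁻ t, ENNReal.ofReal (exp (-α * t)) * G (exp (-t) • x)} with hA
  have hAm : MeasurableSet A := by
    refine measurableSet_lt measurable_const (Measurable.mul (by fun_prop) ?_)
    exact Measurable.lintegral_prod_right' (f := fun z : (E n) × ℝ =>
      ENNReal.ofReal (exp (-α * z.2)) * G (exp (-z.2) • z.1)) (by fun_prop)
  set V : Metric.sphere (0 : E n) 1 → ℝ≥0∞ := fun ω =>
    ∫⁻ u in Ioi (0 : ℝ), ENNReal.ofReal (u ^ (α - 1)) * G (u • (ω : E n)) with hV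
  have hmem : ∀ (ω : Metric.sphere (0 : E n) 1) (ρ : ℝ), 0 < ρ → ρ • (ω : E n) ∈ A →
      ENNReal.ofReal (ρ ^ α * exp (ρ ^ 2)) < V ω / s := by
    intro ω ρ hρ h
    have hnorm : ‖ρ • (ω : E n)‖ = ρ := by simp [norm_smul, hρ.le]
    simp only [hA, mem_ofPred_eq, hnorm, smul_smul] at h
    rw [lintegral_exp_mul_comp_exp_smul α hρ (fun u => G (u • (ω : E n))), ← mul_assoc,
      ← ENNReal.ofReal_mul (by positivity)] at h
    rw [ENNReal.lt_div_iff_mul_lt (Or.inl hs0) (Or.inl hst)]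
    have hc : 0 < ρ ^ α * exp (ρ ^ 2) := by positivity
    have hinv : exp (-ρ ^ 2) * ρ ^ (-α) = (ρ ^ α * exp (ρ ^ 2))⁻¹ := by
      rw [exp_neg, rpow_neg hρ.le, mul_inv, mul_comm]
    rw [hinv, ENNReal.ofReal_inv_of_pos hc, mul_comm, ← div_eq_mul_inv,
      ENNReal.lt_div_iff_mul_lt (Or.inl (by simpa using hc)) (Or.inl (by simp))] at h
    rwa [mul_comm]
  have hVm : Measurable V := Measurable.lintegral_prod_right'
    (f := fun z : Metric.sphere (0 : E n) 1 × ℝ =>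
      ENNReal.ofReal (z.2 ^ (α - 1)) * G (z.2 • (z.1 : E n))) (by fun_prop)
  have hVint : ∫⁻ ω, V ω ∂((volume : Measure (E n)).toSphere) =
      ∫⁻ z, ENNReal.ofReal (‖z‖ ^ (-(1 / 2 : ℝ))) * G z := by
    rw [lintegral_eq_lintegral_sphere hn (by fun_prop)]
    refine lintegral_congr fun ω => setLIntegral_congr_fun measurableSet_Ioi fun ρ hρ => ?_
    have hρ : 0 < ρ := hρ
    have hnorm : ‖ρ • (ω : E n)‖ = ρ := by simp [norm_smul, hρ.le]
    simp only [hnorm]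
    rw [← mul_assoc, ← ENNReal.ofReal_mul (by positivity)]
    congr 2
    rw [← rpow_natCast, ← rpow_add hρ, Nat.cast_sub (by omega)]
    congr 1; push_cast; ring
  calc gammaInv n A = ∫⁻ x, A.indicator 1 x ∂(gammaInv n) := (lintegral_indicator_one hAm).symm
    _ = ∫⁻ ω : Metric.sphere (0 : E n) 1, (∫⁻ ρ in Ioi (0 : ℝ),
      ENNReal.ofReal (ρ ^ (n - 1)) * (ENNReal.ofReal (√π ^ n * exp (‖ρ • (ω : E n)‖ ^ 2)) *
        A.indicator 1 (ρ • (ω : E n)))) ∂((volume : Measure (E n)).toSphere) := by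
        rw [lintegral_gammaInv, lintegral_eq_lintegral_sphere hn]
        exact Measurable.mul (by fun_prop) (measurable_one.indicator hAm)
    _ ≤ ∫⁻ ω : Metric.sphere (0 : E n) 1, (∫⁻ ρ in Ioi (0 : ℝ), ENNReal.ofReal (√π ^ n) *
        {ρ : ℝ | ENNReal.ofReal (ρ ^ α * exp (ρ ^ 2)) < V ω / s}.indicator
      (fun ρ => ENNReal.ofReal (ρ ^ (n - 1) * exp (ρ ^ 2))) ρ)
        ∂((volume : Measure (E n)).toSphere) := by
        refine lintegral_mono fun ω => setLIntegral_mono' measurableSet_Ioi fun ρ hρ => ?_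
        have hρ : 0 < ρ := hρ
        by_cases h : ρ • (ω : E n) ∈ A
        · have hnorm : ‖ρ • (ω : E n)‖ = ρ := by simp [norm_smul, hρ.le]
          have hmem' : ρ ∈ {ρ : ℝ | ENNReal.ofReal (ρ ^ α * exp (ρ ^ 2)) < V ω / s} := hmem ω ρ hρ h
          rw [indicator_of_mem h, indicator_of_mem hmem', hnorm, Pi.one_apply, mul_one,
            ← ENNReal.ofReal_mul (by positivity), ← ENNReal.ofReal_mul (by positivity)]
          apply le_of_eq; congr 1; ring
        · simp [indicator_of_notMem h]
    _ ≤ ∫⁻ ω : Metric.sphere (0 : E n) 1, ENNReal.ofReal (√π ^ n) * (2 * (V ω / s))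
        ∂((volume : Measure (E n)).toSphere) := by
        refine lintegral_mono fun ω => ?_
        rw [lintegral_const_mul' _ _ (by simp)]
        gcongr
        exact lintegral_sublevel_le hn _
    _ = ∫⁻ ω : Metric.sphere (0 : E n) 1, ENNReal.ofReal (√π ^ n) * 2 / s * V ω
        ∂((volume : Measure (E n)).toSphere) := by
        refine lintegral_congr fun ω => ?_
        simp only [div_eq_mul_inv]; ring
    _ = _ := by rw [lintegral_const_mul _ hVm, hVint]

/-! ### Weak type: large times and the splitting at t = 1 -/

/-- The exponent equals -|x|² - |y - rx|²/(1 - r²), and 1/(1 - r²) ≥ 1. For t > 1 one has r ≤ 1/2,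
so 1/√(1 - r²) ≤ 2, which a factor of π absorbs. -/
theorem mehler_le_of_one_lt {t : ℝ} (ht : 1 < t) (x y : E n) :
    mehler (exp (-t)) x y ≤
      exp (-n * t) * exp (-‖x‖ ^ 2) * exp (-1 * ‖y - exp (-t) • x‖ ^ 2) := by
  have h3 : exp (-n * t) = exp (-t) ^ n := by rw [← exp_nat_mul]; congr 1; ring
  have hr2 : exp (-t) ≤ 1 / 2 := by
    rw [exp_neg, ← one_div]
    apply one_div_le_one_div_of_le (by norm_num)
    have := add_one_le_exp t
    linarith
  rw [h3]
  set r := exp (-t)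
  have hr0 : 0 < r := exp_pos _
  have h1 : 1 / 4 ≤ 1 - r ^ 2 := by nlinarith
  have h1' : 0 < 1 - r ^ 2 := by linarith
  have hs : 1 / 2 ≤ √(1 - r ^ 2) := le_sqrt_of_sq_le (by linarith)
  have hc : (π ^ n)⁻¹ * (r / √(1 - r ^ 2)) ^ n ≤ r ^ n := by
    rw [← inv_pow, ← mul_pow]
    gcongr
    have : r / √(1 - r ^ 2) ≤ r / (1 / 2) := by gcongr
    calc π⁻¹ * (r / √(1 - r ^ 2)) ≤ 2⁻¹ * (r / (1 / 2)) := by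
          gcongr
          exact two_le_pi
      _ = r := by ring
  have hexp : -(‖x‖ ^ 2 + ‖y‖ ^ 2 - 2 * r * inner ℝ x y) / (1 - r ^ 2) ≤
      -‖x‖ ^ 2 + -1 * ‖y - r • x‖ ^ 2 := by
    have h : ‖y - r • x‖ ^ 2 = ‖y‖ ^ 2 - 2 * r * inner ℝ x y + r ^ 2 * ‖x‖ ^ 2 := by
      rw [norm_sub_sq_real, inner_smul_right, norm_smul, mul_pow, real_inner_comm x y]
      simp only [norm_eq_abs, sq_abs]; ring
    rw [div_le_iff₀ h1']
    have := sq_nonneg (‖y - r • x‖)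
    nlinarith [mul_nonneg (sq_nonneg r) this]
  unfold mehler
  calc _ ≤ r ^ n * exp (-‖x‖ ^ 2 + -1 * ‖y - r • x‖ ^ 2) := by gcongr
    _ = _ := by rw [exp_add, mul_assoc]

/-- Half a unit of the decay e^{-nt} is given up to absorb the power of t; this is the source of α =
n - 1/2. -/
theorem exists_rpow_le_exp_half (β : ℝ) (c : ℝ) :
    ∃ C : ℝ, 0 ≤ C ∧ ∀ t : ℝ, 1 < t → t ^ (β - 1) / c ≤ C * exp (t / 2) := by
  obtain ⟨m, hm⟩ := exists_nat_ge (β - 1)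
  refine ⟨2 ^ m * m.factorial * |c|⁻¹, by positivity, fun t ht => ?_⟩
  have ht0 : 0 < t := by linarith
  have h1 : t ^ (β - 1) ≤ t ^ m := by
    rw [← rpow_natCast]
    exact rpow_le_rpow_of_exponent_le ht.le hm
  have h2 := pow_div_factorial_le_exp (t / 2) (by positivity) m
  rw [div_le_iff₀ (by positivity), div_pow, div_le_iff₀ (by positivity)] at h2
  calc t ^ (β - 1) / c ≤ |t ^ (β - 1) / c| := le_abs_self _
    _ = t ^ (β - 1) * |c|⁻¹ := by
        rw [abs_div, abs_of_nonneg (by positivity), div_eq_mul_inv]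
    _ ≤ (exp (t / 2) * m.factorial * 2 ^ m) * |c|⁻¹ := by gcongr; linarith
    _ = _ := by ring

theorem lintegral_ball_norm_rpow_lt_top (hn : 0 < n) :
    ∫⁻ z in Metric.ball (0 : E n) 1, ENNReal.ofReal (‖z‖ ^ (-(1 / 2 : ℝ))) < ∞ := by
  have : Nonempty (Fin n) := ⟨⟨0, hn⟩⟩
  have h : IntegrableOn (fun z : E n => ‖z‖ ^ (-(1 / 2 : ℝ))) (Metric.ball 0 1) := by
    rw [integrableOn_fun_norm_addHaar (μ := volume) (f := fun u : ℝ => u ^ (-(1 / 2 : ℝ)))]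
    have h1 : IntegrableOn (fun u : ℝ => u ^ (-(1 / 2 : ℝ))) (Ioo 0 1) := by
      have := intervalIntegral.intervalIntegrable_rpow' (a := 0) (b := 1) (r := -(1 / 2 : ℝ))
        (by norm_num)
      rw [intervalIntegrable_iff_integrableOn_Ioo_of_le zero_le_one] at this
      exact this
    refine Integrable.mono' h1 (by fun_prop) ?_
    filter_upwards [ae_restrict_mem measurableSet_Ioo] with u hu
    have hu0 : 0 ≤ u := hu.1.le
    rw [smul_eq_mul, norm_eq_abs, abs_of_nonneg (by positivity)]
    exact mul_le_of_le_one_left (by positivity) (pow_le_one₀ hu0 hu.2.le)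
  have h2 := h.2
  rw [hasFiniteIntegral_iff_ofReal (Filter.Eventually.of_forall fun z => by positivity)] at h2
  exact h2

/-- In the unit ball the Gaussian is at most one and the power is integrable; outside, the power is
at most one and the Gaussian integral is translation invariant. Hence uniformity in y. -/
theorem exists_lintegral_norm_rpow_mul_gaussian_le (hn : 0 < n) :
    ∃ C : ℝ≥0∞, C ≠ ∞ ∧ ∀ y : E n, ∫⁻ z, ENNReal.ofReal (‖z‖ ^ (-(1 / 2 : ℝ))) *
      ENNReal.ofReal (exp (-1 * ‖y - z‖ ^ 2)) ≤ C := by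
  refine ⟨(∫⁻ z in Metric.ball (0 : E n) 1, ENNReal.ofReal (‖z‖ ^ (-(1 / 2 : ℝ)))) +
    ENNReal.ofReal (√(π / 1) ^ n), ENNReal.add_ne_top.2
      ⟨(lintegral_ball_norm_rpow_lt_top hn).ne, by simp⟩, fun y => ?_⟩
  rw [← lintegral_exp_neg_mul_sq_norm_sub one_pos y, ← lintegral_indicator measurableSet_ball,
    ← lintegral_add_right _ (by fun_prop)]
  refine lintegral_mono fun z => ?_
  rw [norm_sub_rev]
  by_cases hz : z ∈ Metric.ball (0 : E n) 1
  · rw [indicator_of_mem hz]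
    refine le_trans ?_ le_self_add
    refine mul_le_of_le_one_right' ?_
    simp
  · rw [indicator_of_notMem hz, zero_add]
    refine mul_le_of_le_one_left' ?_
    rw [ENNReal.ofReal_le_one]
    refine rpow_le_one_of_one_le_of_nonpos ?_ (by norm_num)
    simpa using hz

/-- The Mehler kernel acting on functions with values in `[0, ∞]`. -/
def mehlerOp (F : (E n) → ℝ≥0∞) (t : ℝ) (x : E n) : ℝ≥0∞ :=
  ∫⁻ y, mehlerE t x y * F y ∂(gammaInv n)

theorem measurable_mehlerOp {F : (E n) → ℝ≥0∞} (hF : Measurable F) :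
    Measurable fun z : (E n) × ℝ => mehlerOp F z.2 z.1 :=
  Measurable.lintegral_prod_right' (f := fun a : ((E n) × ℝ) × (E n) =>
    mehlerE a.1.2 a.1.1 a.2 * F a.2)
    ((measurable_mehlerE_comp (by fun_prop) (by fun_prop) (by fun_prop)).mul (by fun_prop))

theorem potential_eq_lintegral_mehlerOp (β : ℝ) {F : (E n) → ℝ≥0∞} (hF : Measurable F) (x : E n) :
    potential β F x = ∫⁻ t, mehlerOp F t x ∂(riemannLiouville β) := by
  unfold potential mehlerOp
  rw [lintegral_prod]
  exact ((measurable_mehlerE_comp measurable_fst measurable_const measurable_snd).mul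
    (by fun_prop)).aemeasurable

/-- By Tonelli and symmetry this is the unit mass of the kernel. -/
theorem lintegral_mehlerOp {F : (E n) → ℝ≥0∞} (hF : Measurable F) {t : ℝ} (ht : 0 < t) :
    ∫⁻ x, mehlerOp F t x ∂(gammaInv n) = ∫⁻ y, F y ∂(gammaInv n) := by
  unfold mehlerOp
  rw [lintegral_lintegral_swap ((measurable_mehlerE_comp measurable_const measurable_fst
    measurable_snd).mul (by fun_prop)).aemeasurable]
  refine lintegral_congr fun y => ?_
  have hm : Measurable fun x => mehlerE t x y :=
    measurable_mehlerE_comp measurable_const measurable_id measurable_const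
  rw [lintegral_mul_const _ hm]
  simp_rw [mehlerE_comm t _ y]
  rw [lintegral_mehlerE ht, one_mul]

theorem lintegral_potential_Iic_one (β : ℝ) {F : (E n) → ℝ≥0∞} (hF : Measurable F) :
    ∫⁻ x, (∫⁻ t in Iic 1, mehlerOp F t x ∂(riemannLiouville β)) ∂(gammaInv n) =
      riemannLiouville β (Iic 1) * ∫⁻ y, F y ∂(gammaInv n) := by
  rw [lintegral_lintegral_swap (measurable_mehlerOp hF).aemeasurable]
  have h : ∀ᵐ t ∂((riemannLiouville β).restrict (Iic 1)),
      ∫⁻ x, mehlerOp F t x ∂(gammaInv n) = ∫⁻ y, F y ∂(gammaInv n) := by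
    filter_upwards [ae_restrict_of_ae (ae_pos_riemannLiouville β)] with t ht
    exact lintegral_mehlerOp hF ht
  rw [lintegral_congr_ae h, lintegral_const, Measure.restrict_apply_univ, mul_comm]

/-- The convolution of the measure `F γ₋₁` with a Gaussian. -/
def gaussConv (F : (E n) → ℝ≥0∞) (z : E n) : ℝ≥0∞ :=
  ∫⁻ y, ENNReal.ofReal (exp (-1 * ‖y - z‖ ^ 2)) * F y ∂(gammaInv n)

theorem measurable_gaussConv {F : (E n) → ℝ≥0∞} (hF : Measurable F) : Measurable (gaussConv F) :=
  Measurable.lintegral_prod_right' (f := fun a : (E n) × (E n) =>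
    ENNReal.ofReal (exp (-1 * ‖a.2 - a.1‖ ^ 2)) * F a.2) (by fun_prop)

theorem mehlerOp_le_of_one_lt {F : (E n) → ℝ≥0∞} {t : ℝ} (ht : 1 < t) (x : E n) :
    mehlerOp F t x ≤ ENNReal.ofReal (exp (-n * t) * exp (-‖x‖ ^ 2)) *
      gaussConv F (exp (-t) • x) := by
  unfold mehlerOp gaussConv
  rw [← lintegral_const_mul' _ _ ENNReal.ofReal_ne_top]
  refine lintegral_mono fun y => ?_
  rw [← mul_assoc, ← ENNReal.ofReal_mul (by positivity)]
  gcongr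
  exact ENNReal.ofReal_le_ofReal (mehler_le_of_one_lt ht x y)

theorem exists_potential_Ioi_one_le (n : ℕ) (β : ℝ) :
    ∃ C : ℝ≥0∞, C ≠ 0 ∧ C ≠ ∞ ∧ ∀ (F : (E n) → ℝ≥0∞) (x : E n),
      ∫⁻ t in (Iic 1)ᶜ, mehlerOp F t x ∂(riemannLiouville β) ≤
        C * (ENNReal.ofReal (exp (-‖x‖ ^ 2)) *
          ∫⁻ t, ENNReal.ofReal (exp (-((n : ℝ) - 1 / 2) * t)) * gaussConv F (exp (-t) • x)) := by
  obtain ⟨C, hC0, hC⟩ := exists_rpow_le_exp_half β (Gamma β)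
  -- The added 1 keeps the constant nonzero, since the level s is later divided by it.
  refine ⟨ENNReal.ofReal (C + 1), ?_, by simp, fun F x => ?_⟩
  · simp; linarith
  rw [← lintegral_indicator measurableSet_Iic.compl, lintegral_riemannLiouville, ← mul_assoc,
    ← lintegral_const_mul' _ _ (ENNReal.mul_ne_top ENNReal.ofReal_ne_top ENNReal.ofReal_ne_top)]
  -- Enlarging t > 0 to the whole line lets e^{-t}ρ run through all of (0, ∞).
  refine (setLIntegral_le_lintegral _ _).trans (lintegral_mono fun t => ?_)
  by_cases ht : t ∈ (Iic (1 : ℝ))ᶜ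
  · rw [indicator_of_mem ht]
    have ht : 1 < t := by simpa using ht
    refine (mul_le_mul_right (mehlerOp_le_of_one_lt ht x) _).trans ?_
    have key : ENNReal.ofReal (t ^ (β - 1) / Gamma β) *
        ENNReal.ofReal (exp (-n * t) * exp (-‖x‖ ^ 2)) ≤
        ENNReal.ofReal (C + 1) * ENNReal.ofReal (exp (-‖x‖ ^ 2)) *
          ENNReal.ofReal (exp (-((n : ℝ) - 1 / 2) * t)) := by
      rw [← ENNReal.ofReal_mul' (by positivity), ← ENNReal.ofReal_mul' (by positivity),
        ← ENNReal.ofReal_mul' (by positivity)]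
      apply ENNReal.ofReal_le_ofReal
      calc t ^ (β - 1) / Gamma β * (exp (-n * t) * exp (-‖x‖ ^ 2)) ≤
          ((C + 1) * exp (t / 2)) * (exp (-n * t) * exp (-‖x‖ ^ 2)) := by
            gcongr
            refine (hC t ht).trans ?_
            gcongr
            linarith
        _ = (C + 1) * exp (-‖x‖ ^ 2) * (exp (t / 2) * exp (-n * t)) := by ring
        _ = _ := by rw [← exp_add]; congr 2; ring
    rw [← mul_assoc, ← mul_assoc]
    gcongr
  · rw [indicator_of_notMem ht, mul_zero]; exact zero_le

theorem exists_gammaInv_potential_le (hn : 0 < n) {β : ℝ} (hβ : 0 < β) :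
    ∃ C : ℝ≥0, ∀ F : (E n) → ℝ≥0∞, Measurable F → ∀ s : ℝ≥0∞, s ≠ 0 → s ≠ ∞ →
      gammaInv n {x | s < potential β F x} ≤ C / s * ∫⁻ y, F y ∂(gammaInv n) := by
  obtain ⟨C₁, hC₁0, hC₁t, hC₁⟩ := exists_potential_Ioi_one_le n β
  obtain ⟨C₂, hC₂t, hC₂⟩ := exists_lintegral_norm_rpow_mul_gaussian_le hn
  set C : ℝ≥0∞ := riemannLiouville β (Iic 1) * 2 + ENNReal.ofReal (√π ^ n) * 2 * 2 * C₁ * C₂ with hC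
  have hCt : C ≠ ∞ := by
    refine ENNReal.add_ne_top.2 ⟨ENNReal.mul_ne_top (riemannLiouville_Iic_one_lt_top hβ).ne
      (by simp), ENNReal.mul_ne_top (ENNReal.mul_ne_top ?_ hC₁t) hC₂t⟩
    exact ENNReal.mul_ne_top (ENNReal.mul_ne_top ENNReal.ofReal_ne_top (by simp)) (by simp)
  refine ⟨C.toNNReal, fun F hF s hs0 hst => ?_⟩
  rw [ENNReal.coe_toNNReal hCt]
  have h2 : ∫⁻ z, ENNReal.ofReal (‖z‖ ^ (-(1 / 2 : ℝ))) * gaussConv F z ≤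
      C₂ * ∫⁻ y, F y ∂(gammaInv n) := by
    calc _ = ∫⁻ z, ∫⁻ y, ENNReal.ofReal (‖z‖ ^ (-(1 / 2 : ℝ))) *
          (ENNReal.ofReal (exp (-1 * ‖y - z‖ ^ 2)) * F y) ∂(gammaInv n) := by
          refine lintegral_congr fun z => ?_
          rw [gaussConv, lintegral_const_mul' _ _ ENNReal.ofReal_ne_top]
      _ = ∫⁻ y, (∫⁻ z, ENNReal.ofReal (‖z‖ ^ (-(1 / 2 : ℝ))) *
          (ENNReal.ofReal (exp (-1 * ‖y - z‖ ^ 2)) * F y)) ∂(gammaInv n) :=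
          lintegral_lintegral_swap (by fun_prop)
      _ ≤ ∫⁻ y, C₂ * F y ∂(gammaInv n) := by
          refine lintegral_mono fun y => ?_
          simp_rw [← mul_assoc]
          rw [lintegral_mul_const _ (by fun_prop)]
          gcongr
          exact hC₂ y
      _ = _ := lintegral_const_mul _ hF
  -- If the potential exceeds s, one of the two time ranges contributes at least s/2.
  have hsub : {x | s < potential β F x} ⊆
      {x | s / 2 ≤ ∫⁻ t in Iic 1, mehlerOp F t x ∂(riemannLiouville β)} ∪
      {x | s / 2 / C₁ < ENNReal.ofReal (exp (-‖x‖ ^ 2)) *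
          ∫⁻ t, ENNReal.ofReal (exp (-((n : ℝ) - 1 / 2) * t)) * gaussConv F (exp (-t) • x)} := by
    intro x hx
    have hx : s < potential β F x := hx
    by_contra h
    simp only [mem_union, mem_ofPred_eq, not_or, not_le, not_lt] at h
    obtain ⟨ha, hb⟩ := h
    rw [ENNReal.le_div_iff_mul_le (Or.inl hC₁0) (Or.inl hC₁t), mul_comm] at hb
    rw [potential_eq_lintegral_mehlerOp β hF, ← lintegral_add_compl _ measurableSet_Iic] at hx
    have := hx.trans_le (add_le_add ha.le ((hC₁ F x).trans hb))
    rw [ENNReal.add_halves] at this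
    exact lt_irrefl _ this
  have hs2 : s / 2 ≠ 0 := by simpa using hs0
  have hs2t : s / 2 ≠ ∞ := ENNReal.div_ne_top hst (by simp)
  have hlo := meas_ge_le_lintegral_div (μ := gammaInv n)
    (f := fun x => ∫⁻ t in Iic 1, mehlerOp F t x ∂(riemannLiouville β))
    (Measurable.lintegral_prod_right' (measurable_mehlerOp hF)).aemeasurable hs2 hs2t
  rw [lintegral_potential_Iic_one β hF] at hlo
  have hhi := gammaInv_superlevel_le hn (measurable_gaussConv hF) (s := s / 2 / C₁)
    (ENNReal.div_ne_zero.2 ⟨hs2, hC₁t⟩) (ENNReal.div_ne_top hs2t hC₁0)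
  have hs2i : (s / 2)⁻¹ = 2 * s⁻¹ := by
    rw [ENNReal.inv_div (by simp) (by simp), div_eq_mul_inv]
  have hsCi : (s / 2 / C₁)⁻¹ = C₁ * (2 * s⁻¹) := by
    rw [ENNReal.inv_div (Or.inl hC₁t) (Or.inl hC₁0), div_eq_mul_inv, hs2i]
  calc _ ≤ _ := measure_mono hsub
    _ ≤ _ := measure_union_le _ _
    _ ≤ _ := add_le_add hlo (hhi.trans (mul_le_mul_right h2 _))
    _ = _ := by
      rw [div_eq_mul_inv, div_eq_mul_inv (ENNReal.ofReal (√π ^ n) * 2), hs2i, hsCi, hC,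
        div_eq_mul_inv]
      ring

/-! ### Hermite functions in one variable -/

/-- The function `e^{-z²} H_m(z)`. -/
def hermiteFun (m : ℕ) (z : ℝ) : ℝ := hermite1 m z * exp (-z ^ 2)

theorem hermiteFun_eq_iteratedDeriv (m : ℕ) (z : ℝ) :
    hermiteFun m z = (-1) ^ m * iteratedDeriv m (fun w : ℝ => exp (-w ^ 2)) z := by
  have h : exp (z ^ 2) * exp (-z ^ 2) = 1 := by rw [← exp_add]; simp
  unfold hermiteFun hermite1
  linear_combination (-1) ^ m * iteratedDeriv m (fun w : ℝ => exp (-w ^ 2)) z * h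

theorem hermite1_zero (z : ℝ) : hermite1 0 z = 1 := by
  simp [hermite1, ← exp_add]

theorem hermite1_eq_hermiteFun (m : ℕ) (z : ℝ) : hermite1 m z = exp (z ^ 2) * hermiteFun m z := by
  have h : exp (z ^ 2) * exp (-z ^ 2) = 1 := by rw [← exp_add]; simp
  unfold hermiteFun
  linear_combination -(hermite1 m z) * h

theorem hasDerivAt_hermiteFun (m : ℕ) (z : ℝ) :
    HasDerivAt (hermiteFun m) (-hermiteFun (m + 1) z) z := by
  have hg : ContDiff ℝ ⊤ fun w : ℝ => exp (-w ^ 2) := by fun_prop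
  have hd : Differentiable ℝ (iteratedDeriv m fun w : ℝ => exp (-w ^ 2)) :=
    hg.differentiable_iteratedDeriv m (by exact_mod_cast WithTop.coe_lt_top _)
  rw [funext (hermiteFun_eq_iteratedDeriv m), hermiteFun_eq_iteratedDeriv, iteratedDeriv_succ]
  have := ((hd z).hasDerivAt).const_mul ((-1 : ℝ) ^ m)
  convert! this using 1
  rw [pow_succ]; ring

theorem hermiteFun_one (z : ℝ) : hermiteFun 1 z = 2 * z * hermiteFun 0 z := by
  have h1 := hasDerivAt_hermiteFun 0 z
  have h2 : HasDerivAt (hermiteFun 0) (exp (-z ^ 2) * (-(2 * z))) z := by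
    have h3 : HasDerivAt (fun z : ℝ => -z ^ 2) (-(2 * z)) z := by
      have h4 := (hasDerivAt_pow 2 z).fun_neg
      norm_num at h4
      exact h4
    have h5 : hermiteFun 0 = fun z => exp (-z ^ 2) := by
      ext z; simp [hermiteFun, hermite1_zero]
    rw [h5]
    exact h3.exp
  have h := h1.unique h2
  have h0 : hermiteFun 0 z = exp (-z ^ 2) := by simp [hermiteFun, hermite1_zero]
  rw [h0]
  linarith

/-- Each instance is the derivative of the preceding one, starting from the formula for index one.
-/
theorem hermiteFun_add_two (m : ℕ) (z : ℝ) :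
    hermiteFun (m + 2) z = 2 * z * hermiteFun (m + 1) z - 2 * (m + 1) * hermiteFun m z := by
  induction m generalizing z with
  | zero =>
    have h1 := (((hasDerivAt_id z).const_mul 2).mul (hasDerivAt_hermiteFun 0 z))
    have h2 := hasDerivAt_hermiteFun 1 z
    rw [funext hermiteFun_one] at h2
    have := h1.unique h2
    simp at this ⊢
    linarith
  | succ m ih =>
    have h1 := (((hasDerivAt_id z).const_mul 2).mul (hasDerivAt_hermiteFun (m + 1) z)).sub
      ((hasDerivAt_hermiteFun m z).const_mul (2 * ((m : ℝ) + 1)))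
    have h2 := hasDerivAt_hermiteFun (m + 2) z
    rw [funext ih] at h2
    have := h1.unique h2
    simp at this ⊢
    linarith

theorem hermite1_one (z : ℝ) : hermite1 1 z = 2 * z * hermite1 0 z := by
  simp only [hermite1_eq_hermiteFun, hermiteFun_one]; ring

theorem hermite1_add_two (m : ℕ) (z : ℝ) :
    hermite1 (m + 2) z = 2 * z * hermite1 (m + 1) z - 2 * (m + 1) * hermite1 m z := by
  simp only [hermite1_eq_hermiteFun, hermiteFun_add_two]; ring

theorem hasDerivAt_hermite1_succ (m : ℕ) (z : ℝ) :
    HasDerivAt (hermite1 (m + 1)) (2 * (m + 1) * hermite1 m z) z := by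
  rw [funext (hermite1_eq_hermiteFun (m + 1))]
  have h1 := (hasDerivAt_pow 2 z).exp.mul (hasDerivAt_hermiteFun (m + 1) z)
  convert! h1 using 1
  rw [hermiteFun_add_two, hermite1_eq_hermiteFun]
  simp; ring

theorem continuous_hermite1 (m : ℕ) : Continuous (hermite1 m) := by
  obtain ⟨P, hP⟩ := hermite1_eq_poly m
  rw [funext hP]
  exact P.continuous

theorem continuous_hermiteFun (m : ℕ) : Continuous (hermiteFun m) :=
  (continuous_hermite1 m).mul (by fun_prop)

theorem integrable_hermite1_mul_hermiteFun (l m : ℕ) :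
    Integrable fun z => hermite1 l z * hermiteFun m z := by
  obtain ⟨P, hP⟩ := hermite1_eq_poly l
  obtain ⟨Q, hQ⟩ := hermite1_eq_poly m
  refine (integrable_poly_mul_gaussian (P * Q)).congr (Filter.Eventually.of_forall fun z => ?_)
  simp only [hermiteFun, hP, hQ, Polynomial.eval_mul, mul_assoc]

theorem integral_hermite1_zero_mul_hermiteFun_succ (m : ℕ) :
    ∫ z, hermite1 0 z * hermiteFun (m + 1) z = 0 := by
  have h := integral_eq_zero_of_hasDerivAt_of_integrable
    (f := fun z => -hermiteFun m z) (f' := fun z => hermite1 0 z * hermiteFun (m + 1) z)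
    (fun z => by simpa [hermite1_zero] using (hasDerivAt_hermiteFun m z).fun_neg)
    (integrable_hermite1_mul_hermiteFun 0 (m + 1))
    (by simpa [hermite1_zero] using (integrable_hermite1_mul_hermiteFun 0 m).neg)
  exact h

/-- Integration by parts, with one factor lowered and the other raised by differentiation. Lowering
both indices together yields orthogonality and the positivity of the norms by induction. -/
theorem integral_hermite1_succ_mul_hermiteFun_succ (l m : ℕ) :
    ∫ z, hermite1 (l + 1) z * hermiteFun (m + 1) z =
      2 * (l + 1) * ∫ z, hermite1 l z * hermiteFun m z := by
  have h := integral_eq_zero_of_hasDerivAt_of_integrable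
    (f := fun z => hermite1 (l + 1) z * hermiteFun m z)
    (f' := fun z => 2 * (l + 1) * hermite1 l z * hermiteFun m z +
      hermite1 (l + 1) z * -hermiteFun (m + 1) z)
    (fun z => (hasDerivAt_hermite1_succ l z).mul (hasDerivAt_hermiteFun m z))
    ((((integrable_hermite1_mul_hermiteFun l m).const_mul (2 * ((l : ℝ) + 1))).sub
        (integrable_hermite1_mul_hermiteFun (l + 1) (m + 1))).congr
          (Filter.Eventually.of_forall fun z => by simp only [Pi.sub_apply]; ring))
    (integrable_hermite1_mul_hermiteFun (l + 1) m)
  have h2 : ∀ z, 2 * ((l : ℝ) + 1) * hermite1 l z * hermiteFun m z +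
      hermite1 (l + 1) z * -hermiteFun (m + 1) z =
      2 * ((l : ℝ) + 1) * (hermite1 l z * hermiteFun m z) -
        hermite1 (l + 1) z * hermiteFun (m + 1) z := fun z => by ring
  simp_rw [h2] at h
  rw [integral_sub ((integrable_hermite1_mul_hermiteFun l m).const_mul _)
    (integrable_hermite1_mul_hermiteFun _ _), integral_const_mul] at h
  linarith

theorem integral_hermite1_mul_hermiteFun_of_ne {l m : ℕ} (h : l ≠ m) :
    ∫ z, hermite1 l z * hermiteFun m z = 0 := by
  induction l generalizing m with
  | zero =>
    obtain ⟨m, rfl⟩ := Nat.exists_eq_succ_of_ne_zero h.symm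
    exact integral_hermite1_zero_mul_hermiteFun_succ m
  | succ l ih =>
    rcases m with _ | m
    · have := integral_hermite1_zero_mul_hermiteFun_succ l
      simp only [hermiteFun] at this ⊢
      rw [← this]
      congr 1; ext z; ring
    · rw [integral_hermite1_succ_mul_hermiteFun_succ, ih (by omega), mul_zero]

theorem integral_hermite1_mul_hermiteFun_self_pos (m : ℕ) :
    0 < ∫ z, hermite1 m z * hermiteFun m z := by
  induction m with
  | zero =>
    simp only [hermite1_zero, hermiteFun, one_mul]
    have := integral_gaussian 1
    simp only [neg_mul, one_mul, div_one] at this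
    rw [this]
    exact sqrt_pos.2 pi_pos
  | succ m ih =>
    rw [integral_hermite1_succ_mul_hermiteFun_succ]
    positivity

theorem exists_abs_eval_le_mul_exp_sq (P : Polynomial ℝ) :
    ∃ C : ℝ, ∀ z, |P.eval z| ≤ C * exp (z ^ 2) := by
  induction P using Polynomial.induction_on' with
  | add p q hp hq =>
    obtain ⟨C, hC⟩ := hp
    obtain ⟨D, hD⟩ := hq
    refine ⟨C + D, fun z => ?_⟩
    rw [Polynomial.eval_add, add_mul]
    exact (abs_add_le _ _).trans (add_le_add (hC z) (hD z))
  | monomial m a =>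
    refine ⟨|a| * (m.factorial * exp 1), fun z => ?_⟩
    have h1 := pow_div_factorial_le_exp |z| (abs_nonneg z) m
    rw [div_le_iff₀ (by positivity)] at h1
    have h2 : exp |z| ≤ exp 1 * exp (z ^ 2) := by
      rw [← exp_add, exp_le_exp]
      nlinarith [sq_abs z, sq_nonneg (|z| - 1), abs_nonneg z]
    rw [Polynomial.eval_monomial, abs_mul, abs_pow]
    calc |a| * |z| ^ m ≤ |a| * (exp |z| * m.factorial) := by gcongr
      _ ≤ |a| * (exp 1 * exp (z ^ 2) * m.factorial) := by gcongr
      _ = _ := by ring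

theorem exists_abs_hermiteFun_le (m : ℕ) : ∃ C, ∀ z, |hermiteFun m z| ≤ C := by
  obtain ⟨P, hP⟩ := hermite1_eq_poly m
  obtain ⟨C, hC⟩ := exists_abs_eval_le_mul_exp_sq P
  refine ⟨C, fun z => ?_⟩
  have h : exp (z ^ 2) * exp (-z ^ 2) = 1 := by rw [← exp_add]; simp
  rw [hermiteFun, hP, abs_mul, abs_of_pos (exp_pos _)]
  calc _ ≤ C * exp (z ^ 2) * exp (-z ^ 2) := by gcongr; exact hC z
    _ = C := by rw [mul_assoc, h, mul_one]

/-! ### Eigenfunctions of Mehler's kernel -/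

/-- Induction on m by differentiating in x: both sides raise the index, and the chain rule
contributes 1/r on the left, which accounts for r^m. Boundedness of the Hermite functions justifies
differentiation under the integral. -/
theorem integral_gaussian_mul_hermiteFun_comp_sub {r : ℝ} (hr0 : 0 < r) (hr1 : r < 1) (m : ℕ)
    (x : ℝ) :
    ∫ u, exp (-(r ^ 2 / (1 - r ^ 2)) * u ^ 2) * hermiteFun m (x / r - u) =
      √π * √(1 - r ^ 2) * r ^ m * hermiteFun m x := by
  have hr2 : 0 < 1 - r ^ 2 := by nlinarith
  have hb : 0 < r ^ 2 / (1 - r ^ 2) := by positivity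
  induction m generalizing x with
  | zero =>
    have key : ∀ u, exp (-(r ^ 2 / (1 - r ^ 2)) * u ^ 2) * hermiteFun 0 (x / r - u) =
        exp (-x ^ 2) * exp (-(1 / (1 - r ^ 2)) * (u - (x / r - r * x)) ^ 2) := by
      intro u
      simp only [hermiteFun, hermite1_zero, one_mul]
      rw [← exp_add, ← exp_add]
      congr 1
      field_simp
      ring
    simp_rw [key]
    rw [integral_const_mul, integral_sub_right_eq_self
      (fun u => exp (-(1 / (1 - r ^ 2)) * u ^ 2)), integral_gaussian]
    simp only [hermiteFun, hermite1_zero, one_mul, pow_zero, mul_one, one_div, div_inv_eq_mul]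
    rw [sqrt_mul pi_pos.le]; ring
  | succ m ih =>
    obtain ⟨C, hC⟩ := exists_abs_hermiteFun_le m
    obtain ⟨C', hC'⟩ := exists_abs_hermiteFun_le (m + 1)
    have hc := continuous_hermiteFun m
    have hc' := continuous_hermiteFun (m + 1)
    have hInt := integrable_exp_neg_mul_sq hb
    have hF := hasDerivAt_integral_of_dominated_loc_of_deriv_le (μ := volume) (x₀ := x)
      (s := univ) (F := fun x u => exp (-(r ^ 2 / (1 - r ^ 2)) * u ^ 2) * hermiteFun m (x / r - u))
      (F' := fun x u => exp (-(r ^ 2 / (1 - r ^ 2)) * u ^ 2) *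
        (-hermiteFun (m + 1) (x / r - u) * (1 / r)))
      (bound := fun u => exp (-(r ^ 2 / (1 - r ^ 2)) * u ^ 2) * (C' * (1 / r)))
      Filter.univ_mem
      (Filter.Eventually.of_forall fun y => by fun_prop)
      (hInt.mul_bdd (c := C) (by fun_prop)
        (Filter.Eventually.of_forall fun u => hC _))
      (by fun_prop)
      (Filter.Eventually.of_forall fun u y _ => by
        rw [norm_mul, norm_mul, norm_neg, norm_of_nonneg (exp_pos _).le,
          norm_of_nonneg (by positivity : 0 ≤ 1 / r)]
        gcongr
        exact hC' _)
      (hInt.mul_const _)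
      (Filter.Eventually.of_forall fun u y _ => by
        have h1 : HasDerivAt (fun y => y / r - u) (1 / r) y :=
          ((hasDerivAt_id y).div_const r).sub_const u
        exact ((hasDerivAt_hermiteFun m (y / r - u)).comp y h1).const_mul _)
    have h2 := (hasDerivAt_hermiteFun m x).const_mul (√π * √(1 - r ^ 2) * r ^ m)
    rw [← funext ih] at h2
    have h3 := hF.2.unique h2
    have h4 : ∀ u, exp (-(r ^ 2 / (1 - r ^ 2)) * u ^ 2) *
        (-hermiteFun (m + 1) (x / r - u) * (1 / r)) = (-(1 / r)) *
          (exp (-(r ^ 2 / (1 - r ^ 2)) * u ^ 2) * hermiteFun (m + 1) (x / r - u)) :=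
      fun u => by ring
    simp_rw [h4] at h3
    rw [integral_const_mul] at h3
    set J := ∫ u, exp (-(r ^ 2 / (1 - r ^ 2)) * u ^ 2) * hermiteFun (m + 1) (x / r - u)
    have h5 : (1 / r) * r = 1 := by field_simp
    rw [pow_succ r m]
    linear_combination -r * h3 - J * h5

theorem integral_mehler1_mul_hermiteFun {r : ℝ} (hr0 : 0 < r) (hr1 : r < 1) (m : ℕ) (x : ℝ) :
    ∫ y, (√π)⁻¹ * (r / √(1 - r ^ 2)) * exp (-(x - r * y) ^ 2 / (1 - r ^ 2)) * hermiteFun m y =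
      r ^ (m + 1) * hermiteFun m x := by
  have hr2 : 0 < 1 - r ^ 2 := by nlinarith
  have h := integral_gaussian_mul_hermiteFun_comp_sub hr0 hr1 m x
  rw [← integral_sub_left_eq_self _ volume (x / r)] at h
  have key : ∀ y, (√π)⁻¹ * (r / √(1 - r ^ 2)) * exp (-(x - r * y) ^ 2 / (1 - r ^ 2)) *
      hermiteFun m y = (√π)⁻¹ * (r / √(1 - r ^ 2)) *
      (exp (-(r ^ 2 / (1 - r ^ 2)) * (x / r - y) ^ 2) * hermiteFun m (x / r - (x / r - y))) := by
    intro y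
    rw [sub_sub_cancel, mul_assoc]
    congr 3
    field_simp
  simp_rw [key]
  rw [integral_const_mul, h]
  have := sqrt_pos.2 pi_pos
  have := sqrt_pos.2 hr2
  field_simp
  ring

theorem exp_neg_sq_norm_eq_prod (x : E n) : exp (-‖x‖ ^ 2) = ∏ i, exp (-(x i) ^ 2) := by
  rw [← exp_sum, EuclideanSpace.real_norm_sq_eq]
  simp

theorem hermiteTilde_eq_prod (k : Fin n → ℕ) (x : E n) :
    hermiteTilde k x = ∏ i, hermiteFun (k i) (x i) := by
  simp only [hermiteTilde, hermiteN, hermiteFun, Finset.prod_mul_distrib,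
    exp_neg_sq_norm_eq_prod]
  ring

theorem integral_gammaInv {V : Type*} [NormedAddCommGroup V] [NormedSpace ℝ V] (f : (E n) → V) :
    ∫ y, f y ∂(gammaInv n) = ∫ y, (√π ^ n * exp (‖y‖ ^ 2)) • f y := by
  unfold gammaInv
  rw [integral_withDensity_eq_integral_toReal_smul (by fun_prop) (by simp)]
  congr 1; ext y
  rw [ENNReal.toReal_ofReal (by positivity), pi_rpow_half]

theorem integral_prod_apply_euclidean (f : Fin n → ℝ → ℝ) :
    ∫ y : E n, ∏ i, f i (y i) = ∏ i, ∫ z, f i z := by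
  rw [← integral_fintype_prod_volume_eq_prod,
    ← (PiLp.volume_preserving_toLp (Fin n)).integral_comp
      (MeasurableEquiv.toLp 2 _).measurableEmbedding]

/-- With the density e^{|y|²} included, the exponent is -∑(x_i - r y_i)²/(1 - r²), so the integral
factors over coordinates. Each factor contributes r^{k_i+1}, hence the shift by n. -/
theorem integral_mehler_mul_hermiteTilde {r : ℝ} (hr0 : 0 < r) (hr1 : r < 1) (k : Fin n → ℕ)
    (x : E n) :
    ∫ y, mehler r x y * hermiteTilde k y ∂(gammaInv n) =
      r ^ ((∑ i, k i) + n) * hermiteTilde k x := by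
  have hr2 : 0 < 1 - r ^ 2 := by nlinarith
  have hpi := sqrt_pos.2 pi_pos
  have key : ∀ y : E n, (√π ^ n * exp (‖y‖ ^ 2)) • (mehler r x y * hermiteTilde k y) =
      ∏ i, ((√π)⁻¹ * (r / √(1 - r ^ 2)) * exp (-(x i - r * y i) ^ 2 / (1 - r ^ 2)) *
        hermiteFun (k i) (y i)) := by
    intro y
    rw [Finset.prod_mul_distrib, Finset.prod_mul_distrib, Finset.prod_const, Finset.card_univ,
      Fintype.card_fin, ← exp_sum, hermiteTilde_eq_prod, mehler, smul_eq_mul]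
    have h1 : √π ^ n * (π ^ n)⁻¹ = (√π)⁻¹ ^ n := by
      nth_rewrite 2 [← mul_self_sqrt pi_pos.le]
      rw [mul_pow, inv_pow]
      field_simp
    have h2 : ∑ i, -(x i - r * y i) ^ 2 / (1 - r ^ 2) =
        ‖y‖ ^ 2 + -(‖x‖ ^ 2 + ‖y‖ ^ 2 - 2 * r * inner ℝ x y) / (1 - r ^ 2) := by
      have h3 : ∑ i, (x i - r * y i) ^ 2 = ‖x‖ ^ 2 - 2 * r * inner ℝ x y + r ^ 2 * ‖y‖ ^ 2 := by
        rw [EuclideanSpace.real_norm_sq_eq, EuclideanSpace.real_norm_sq_eq, PiLp.inner_apply,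
          Finset.mul_sum, Finset.mul_sum, ← Finset.sum_sub_distrib, ← Finset.sum_add_distrib]
        refine Finset.sum_congr rfl fun i _ => ?_
        simp; ring
      rw [← Finset.sum_div, Finset.sum_neg_distrib, h3]
      field_simp
      ring
    rw [h2, exp_add, mul_pow, ← h1]
    ring
  rw [integral_gammaInv]
  simp_rw [key]
  rw [integral_prod_apply_euclidean (fun i z => (√π)⁻¹ * (r / √(1 - r ^ 2)) *
    exp (-(x i - r * z) ^ 2 / (1 - r ^ 2)) * hermiteFun (k i) z)]
  simp_rw [integral_mehler1_mul_hermiteFun hr0 hr1]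
  rw [Finset.prod_mul_distrib, Finset.prod_pow_eq_pow_sum, hermiteTilde_eq_prod,
    Finset.sum_add_distrib]
  simp

theorem integral_hermiteTilde_mul_hermiteTilde (k l : Fin n → ℕ) :
    ∫ y, hermiteTilde k y * hermiteTilde l y ∂(gammaInv n) =
      √π ^ n * ∏ i, ∫ z, hermite1 (k i) z * hermiteFun (l i) z := by
  rw [integral_gammaInv, ← integral_prod_apply_euclidean, ← integral_const_mul]
  congr 1; ext y
  have h : exp (‖y‖ ^ 2) * exp (-‖y‖ ^ 2) = 1 := by rw [← exp_add]; simp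
  rw [hermiteTilde_eq_prod l, Finset.prod_mul_distrib, hermiteTilde, hermiteN, smul_eq_mul]
  linear_combination (√π ^ n * (∏ i, hermite1 (k i) (y i)) * ∏ i, hermiteFun (l i) (y i)) * h

theorem integral_hermiteTilde_mul_hermiteTilde_of_ne {k l : Fin n → ℕ} (h : k ≠ l) :
    ∫ y, hermiteTilde k y * hermiteTilde l y ∂(gammaInv n) = 0 := by
  obtain ⟨i, hi⟩ := Function.ne_iff.1 h
  rw [integral_hermiteTilde_mul_hermiteTilde,
    Finset.prod_eq_zero (Finset.mem_univ i) (integral_hermite1_mul_hermiteFun_of_ne hi), mul_zero]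

theorem integral_hermiteTilde_sq_pos (k : Fin n → ℕ) :
    0 < ∫ y, hermiteTilde k y * hermiteTilde k y ∂(gammaInv n) := by
  rw [integral_hermiteTilde_mul_hermiteTilde]
  have := sqrt_pos.2 pi_pos
  exact mul_pos (by positivity)
    (Finset.prod_pos fun i _ => integral_hermite1_mul_hermiteFun_self_pos (k i))

/-! ### Completeness of the Hermite system -/

/-- The linear span of the Hermite polynomials. -/
def hermiteSpan (n : ℕ) : Submodule ℝ ((E n) → ℝ) := Submodule.span ℝ (range hermiteN)

theorem hermiteN_update (k : Fin n → ℕ) (i : Fin n) (m : ℕ) (x : E n) :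
    hermiteN (Function.update k i m) x =
      hermite1 m (x i) * ∏ j ∈ Finset.univ.erase i, hermite1 (k j) (x j) := by
  rw [hermiteN, ← Finset.mul_prod_erase _ _ (Finset.mem_univ i), Function.update_self]
  congr 1
  refine Finset.prod_congr rfl fun j hj => ?_
  rw [Function.update_of_ne (Finset.ne_of_mem_erase hj)]

/-- The recurrence read backwards: z H_{m+1} = H_{m+2}/2 + (m+1) H_m, and z H_0 = H_1/2. -/
theorem coord_mul_mem_hermiteSpan (i : Fin n) {P : (E n) → ℝ} (hP : P ∈ hermiteSpan n) :
    (fun x : E n => x i * P x) ∈ hermiteSpan n := by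
  induction hP using Submodule.span_induction with
  | mem P hP =>
    obtain ⟨k, rfl⟩ := hP
    have hk : hermiteN k = hermiteN (Function.update k i (k i)) := by simp
    rw [hk]
    have hmem : ∀ m, hermiteN (Function.update k i m) ∈ hermiteSpan n := fun m =>
      Submodule.subset_span ⟨_, rfl⟩
    rcases k i with _ | m
    · convert! (hermiteSpan n).smul_mem (1 / 2 : ℝ) (hmem 1) using 1
      ext x
      simp only [Pi.smul_apply, smul_eq_mul, hermiteN_update, hermite1_one]
      ring
    · convert! (hermiteSpan n).add_mem ((hermiteSpan n).smul_mem (1 / 2 : ℝ) (hmem (m + 2)))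
        ((hermiteSpan n).smul_mem ((m : ℝ) + 1) (hmem m)) using 1
      ext x
      simp only [Pi.smul_apply, Pi.add_apply, smul_eq_mul, hermiteN_update, hermite1_add_two]
      ring
  | zero =>
    convert! (hermiteSpan n).zero_mem using 1
    ext x; simp
  | add P Q _ _ hP hQ =>
    convert! (hermiteSpan n).add_mem hP hQ using 1
    ext x; simp [mul_add]
  | smul a P _ hP =>
    convert! (hermiteSpan n).smul_mem a hP using 1
    ext x; simp; ring

theorem inner_pow_mem_hermiteSpan (ξ : E n) (m : ℕ) :
    (fun x : E n => inner ℝ x ξ ^ m) ∈ hermiteSpan n := by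
  induction m with
  | zero =>
    refine Submodule.subset_span ⟨0, ?_⟩
    ext x; simp [hermiteN, hermite1_zero]
  | succ m ih =>
    have h := (hermiteSpan n).sum_mem (t := Finset.univ) fun i _ =>
      (hermiteSpan n).smul_mem (ξ i) (coord_mul_mem_hermiteSpan i ih)
    convert! h using 1
    ext x
    have hi : inner ℝ x ξ = ∑ i, ξ i * x i := by simp [PiLp.inner_apply]
    rw [pow_succ, mul_comm]
    nth_rewrite 1 [hi]
    rw [Finset.sum_mul, Finset.sum_apply]
    refine Finset.sum_congr rfl fun i _ => ?_
    simp [mul_assoc]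

theorem memLp_exp_neg_sq_add_linear (c : ℝ) :
    MemLp (fun x : E n => exp (-‖x‖ ^ 2 + c * ‖x‖)) 2 (gammaInv n) := by
  rw [memLp_two_iff_integrable_sq (by fun_prop)]
  unfold gammaInv
  rw [integrable_withDensity_iff (by fun_prop) (by simp)]
  have h0 := GaussianFourier.integral_rexp_neg_mul_sq_norm (V := E n) (b := 1 / 2) (by norm_num)
  have h1 : Integrable fun y : E n => exp (-(1 / 2) * ‖y‖ ^ 2) := by
    by_contra h
    rw [integral_undef h] at h0
    have : 0 < (π / (1 / 2)) ^ (Module.finrank ℝ (E n) / 2 : ℝ) := by positivity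
    exact this.ne h0
  refine (h1.const_mul (√π ^ n * exp (2 * c ^ 2))).mono' (by fun_prop)
    (Filter.Eventually.of_forall fun x => ?_)
  rw [ENNReal.toReal_ofReal (by positivity), pi_rpow_half, norm_of_nonneg (by positivity),
    ← exp_nat_mul]
  have h2 : ((2 : ℕ) : ℝ) * (-‖x‖ ^ 2 + c * ‖x‖) + ‖x‖ ^ 2 ≤ 2 * c ^ 2 + -(1 / 2) * ‖x‖ ^ 2 := by
    push_cast
    nlinarith [sq_nonneg (‖x‖ - 2 * c)]
  have h3 := exp_le_exp.2 h2
  rw [exp_add, exp_add (2 * c ^ 2)] at h3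
  have hpi : 0 < √π ^ n := by positivity
  calc _ = √π ^ n * (exp (((2 : ℕ) : ℝ) * (-‖x‖ ^ 2 + c * ‖x‖)) * exp (‖x‖ ^ 2)) := by ring
    _ ≤ √π ^ n * (exp (2 * c ^ 2) * exp (-(1 / 2) * ‖x‖ ^ 2)) := by gcongr
    _ = _ := by ring

/-- Let w = u e^{-|y|²}. Expanding e^{i⟨y,ξ⟩} in powers, dominated by the integrable e^{|ξ||y|}|w|,
shows that the Fourier transform of wγ₋₁ vanishes. The finite measures with densities w⁺ and w⁻ then
have equal characteristic functions, so w = 0. -/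
theorem ae_eq_zero_of_integral_mul_hermiteTilde {u : (E n) → ℝ} (hu : MemLp u 2 (gammaInv n))
    (h : ∀ k, ∫ y, u y * hermiteTilde k y ∂(gammaInv n) = 0) : u =ᵐ[gammaInv n] 0 := by
  set w : (E n) → ℝ := fun y => u y * exp (-‖y‖ ^ 2) with hw
  have hwc : ∀ c : ℝ, Integrable (fun y => exp (c * ‖y‖) * w y) (gammaInv n) := by
    intro c
    refine (hu.integrable_mul (memLp_exp_neg_sq_add_linear c)).congr
      (Filter.Eventually.of_forall fun y => ?_)
    simp only [hw, Pi.mul_apply, exp_add]; ring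
  have hwi : Integrable w (gammaInv n) := by simpa using hwc 0
  have hspan : ∀ P ∈ hermiteSpan n, Integrable (fun y => P y * w y) (gammaInv n) ∧
      ∫ y, P y * w y ∂(gammaInv n) = 0 := by
    intro P hP
    induction hP using Submodule.span_induction with
    | mem P hP =>
      obtain ⟨k, rfl⟩ := hP
      have he : ∀ y, hermiteN k y * w y = u y * hermiteTilde k y := fun y => by
        simp only [hw, hermiteTilde]; ring
      simp_rw [he]
      exact ⟨hu.integrable_mul (memLp_hermiteTilde ℝ k), h k⟩
    | zero => simp
    | add P Q _ _ hP hQ =>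
      simp only [Pi.add_apply, add_mul]
      exact ⟨hP.1.add hQ.1, by rw [integral_add hP.1 hQ.1, hP.2, hQ.2, add_zero]⟩
    | smul a P _ hP =>
      simp only [Pi.smul_apply, smul_eq_mul, mul_assoc]
      exact ⟨hP.1.const_mul a, by rw [integral_const_mul, hP.2, mul_zero]⟩
  have hchar : ∀ ξ : E n, ∫ y, Complex.exp (inner ℝ y ξ * Complex.I) * (w y : ℂ) ∂(gammaInv n)
      = 0 := by
    intro ξ
    have hsum := hasSum_integral_of_dominated_convergence (μ := gammaInv n)
      (F := fun (m : ℕ) (y : E n) => (inner ℝ y ξ * Complex.I) ^ m / (m.factorial : ℂ) * (w y : ℂ))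
      (f := fun y => Complex.exp (inner ℝ y ξ * Complex.I) * (w y : ℂ))
      (fun m y => |inner ℝ y ξ| ^ m / m.factorial * |w y|)
      (fun m => by
        have := hwi.aestronglyMeasurable
        refine AEStronglyMeasurable.mul (by fun_prop) ?_
        exact Complex.continuous_ofReal.comp_aestronglyMeasurable this)
      (fun m => Filter.Eventually.of_forall fun y => by simp)
      (Filter.Eventually.of_forall fun y =>
        (Real.summable_pow_div_factorial _).mul_right _)
      (by
        have : ∀ y, ∑' m : ℕ, |inner ℝ y ξ| ^ m / m.factorial * |w y| =
            exp |inner ℝ y ξ| * |w y| := fun y => by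
          rw [tsum_mul_right, Real.exp_eq_exp_ℝ, NormedSpace.exp_eq_tsum_div]
        simp_rw [this]
        have hm := hwi.aestronglyMeasurable.norm
        simp only [norm_eq_abs] at hm
        refine (hwc ‖ξ‖).mono (AEStronglyMeasurable.mul (by fun_prop) hm)
          (Filter.Eventually.of_forall fun y => ?_)
        rw [norm_mul, norm_mul, norm_of_nonneg (exp_pos _).le, norm_of_nonneg (exp_pos _).le,
          norm_eq_abs, abs_abs, norm_eq_abs]
        gcongr
        rw [mul_comm]
        exact abs_real_inner_le_norm y ξ)
      (Filter.Eventually.of_forall fun y => by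
        have := NormedSpace.expSeries_div_hasSum_exp (𝔸 := ℂ) ((inner ℝ y ξ : ℝ) * Complex.I)
        rw [← Complex.exp_eq_exp_ℂ] at this
        exact this.mul_right _)
    have hz : ∀ m : ℕ, ∫ y, (inner ℝ y ξ * Complex.I) ^ m / (m.factorial : ℂ) * (w y : ℂ)
        ∂(gammaInv n) = 0 := by
      intro m
      have he : ∀ y : E n, (inner ℝ y ξ * Complex.I) ^ m / (m.factorial : ℂ) * (w y : ℂ) =
          Complex.I ^ m / (m.factorial : ℂ) * ((inner ℝ y ξ ^ m * w y : ℝ) : ℂ) := fun y => by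
        push_cast; ring
      simp_rw [he]
      rw [integral_const_mul, integral_complex_ofReal,
        (hspan _ (inner_pow_mem_hermiteSpan ξ m)).2]
      simp
    simp_rw [hz] at hsum
    exact hsum.unique hasSum_zero
  have hwm : AEMeasurable w (gammaInv n) := hwi.aemeasurable
  have hfin : IsFiniteMeasure ((gammaInv n).withDensity fun y => ENNReal.ofReal (w y)) :=
    isFiniteMeasure_withDensity_ofReal hwi.2
  have hfin' : IsFiniteMeasure ((gammaInv n).withDensity fun y => ENNReal.ofReal (-w y)) :=
    isFiniteMeasure_withDensity_ofReal hwi.neg.2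
  have hInt : ∀ v : (E n) → ℝ, Integrable v (gammaInv n) → ∀ ξ : E n, Integrable (fun y =>
      (ENNReal.ofReal (v y)).toReal • Complex.exp (inner ℝ y ξ * Complex.I)) (gammaInv n) := by
    intro v hv ξ
    have hvm := hv.aemeasurable
    have h1 : AEStronglyMeasurable (fun y => (ENNReal.ofReal (v y)).toReal) (gammaInv n) :=
      AEMeasurable.aestronglyMeasurable (by fun_prop)
    have h2 : AEStronglyMeasurable (fun y : E n => Complex.exp (inner ℝ y ξ * Complex.I))
        (gammaInv n) := by fun_prop
    refine hv.norm.mono' (h1.smul h2)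
      (Filter.Eventually.of_forall fun y => ?_)
    rw [norm_smul, Complex.norm_exp_ofReal_mul_I, mul_one, ENNReal.toReal_ofReal',
      norm_of_nonneg (le_max_right _ _), norm_eq_abs]
    exact max_le (le_abs_self _) (abs_nonneg _)
  have heq : ((gammaInv n).withDensity fun y => ENNReal.ofReal (w y)) =
      (gammaInv n).withDensity fun y => ENNReal.ofReal (-w y) := by
    refine Measure.ext_of_charFun ?_
    ext ξ
    rw [charFun_apply, charFun_apply,
      integral_withDensity_eq_integral_toReal_smul₀ (by fun_prop) (by simp),
      integral_withDensity_eq_integral_toReal_smul₀ (by fun_prop) (by simp), ← sub_eq_zero,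
      ← integral_sub, ← hchar ξ]
    · congr 1; ext y
      have hd : (w y : ℂ) = ((max (w y) 0 - max (-w y) 0 : ℝ) : ℂ) := by
        rw [max_zero_sub_max_neg_zero_eq_self]
      rw [ENNReal.toReal_ofReal', ENNReal.toReal_ofReal', hd]
      simp only [Complex.real_smul]
      push_cast
      ring
    · exact hInt w hwi ξ
    · exact hInt (fun y => -w y) hwi.neg ξ
  rw [withDensity_eq_iff_of_sigmaFinite (by fun_prop) (by fun_prop)] at heq
  filter_upwards [heq] with y hy
  have hwy : w y = 0 := by
    rcases le_total 0 (w y) with h0 | h0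
    · rw [ENNReal.ofReal_of_nonpos (neg_nonpos.2 h0), ENNReal.ofReal_eq_zero] at hy
      exact le_antisymm hy h0
    · rw [ENNReal.ofReal_of_nonpos h0, eq_comm, ENNReal.ofReal_eq_zero] at hy
      linarith
  simpa [hw, (exp_pos _).ne'] using hwy

/-! ### The Hermite expansion in L² -/

variable {𝕜 : Type*} [RCLike 𝕜]

theorem coeFn_hermiteL2 (k : Fin n → ℕ) :
    hermiteL2 𝕜 k =ᵐ[gammaInv n] fun x => ((hermiteTilde k x : ℝ) : 𝕜) :=
  (memLp_hermiteTilde 𝕜 k).coeFn_toLp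

theorem inner_hermiteL2 (k : Fin n → ℕ) (g : Lp 𝕜 2 (gammaInv n)) :
    inner 𝕜 (hermiteL2 𝕜 k) g = ∫ y, g y * ((hermiteTilde k y : ℝ) : 𝕜) ∂(gammaInv n) := by
  rw [L2.inner_def]
  refine integral_congr_ae ?_
  filter_upwards [coeFn_hermiteL2 (𝕜 := 𝕜) k] with y hy
  rw [hy, RCLike.inner_apply, RCLike.conj_ofReal]

theorem inner_hermiteL2_hermiteL2 (k l : Fin n → ℕ) :
    inner 𝕜 (hermiteL2 𝕜 k) (hermiteL2 𝕜 l) =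
      ((∫ y, hermiteTilde k y * hermiteTilde l y ∂(gammaInv n) : ℝ) : 𝕜) := by
  rw [inner_hermiteL2, ← integral_ofReal]
  refine integral_congr_ae ?_
  filter_upwards [coeFn_hermiteL2 (𝕜 := 𝕜) l] with y hy
  rw [hy]
  push_cast
  ring

theorem hermiteL2_ne_zero (k : Fin n → ℕ) : hermiteL2 𝕜 k ≠ 0 := by
  intro h
  have h1 := inner_hermiteL2_hermiteL2 (𝕜 := 𝕜) k k
  rw [h, inner_zero_left] at h1
  have h2 := integral_hermiteTilde_sq_pos k
  have h3 : (∫ y, hermiteTilde k y * hermiteTilde k y ∂(gammaInv n) : ℝ) = 0 := by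
    exact_mod_cast h1.symm
  exact h2.ne' h3

theorem coeff_eq_inner (f : Lp 𝕜 2 (gammaInv n)) (k : Fin n → ℕ) :
    coeff f k = inner 𝕜 (hermiteL2 𝕜 k) f / ((‖hermiteL2 𝕜 k‖ ^ 2 : ℝ) : 𝕜) := by
  rw [inner_hermiteL2, integral_gammaInv, coeff]
  have h : ∀ y : E n, (√π ^ n * exp (‖y‖ ^ 2)) • (f y * ((hermiteTilde k y : ℝ) : 𝕜)) =
      ((√π ^ n : ℝ) : 𝕜) * (f y * ((hermiteTilde k y * exp (‖y‖ ^ 2) : ℝ) : 𝕜)) := by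
    intro y
    rw [RCLike.real_smul_eq_coe_mul]
    push_cast
    ring
  simp_rw [h]
  rw [integral_const_mul, pi_rpow_half]
  push_cast
  ring

/-- The normalized functions `H̃_k`. -/
def hermiteUnit (𝕜 : Type*) [RCLike 𝕜] (k : Fin n → ℕ) : Lp 𝕜 2 (gammaInv n) :=
  ((‖hermiteL2 𝕜 k‖⁻¹ : ℝ) : 𝕜) • hermiteL2 𝕜 k

theorem orthonormal_hermiteUnit : Orthonormal 𝕜 (hermiteUnit (n := n) 𝕜) := by
  refine ⟨fun k => ?_, fun k l hkl => ?_⟩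
  · have := norm_pos_iff.2 (hermiteL2_ne_zero (𝕜 := 𝕜) k)
    rw [hermiteUnit, norm_smul, RCLike.norm_ofReal, abs_of_pos (by positivity),
      inv_mul_cancel₀ this.ne']
  · simp only [hermiteUnit]
    rw [inner_smul_left, inner_smul_right, inner_hermiteL2_hermiteL2,
      integral_hermiteTilde_mul_hermiteTilde_of_ne hkl]
    simp

/-- The H̃_k are real, so real and imaginary parts can be treated separately. -/
theorem eq_zero_of_inner_hermiteL2 {g : Lp 𝕜 2 (gammaInv n)}
    (h : ∀ k, inner 𝕜 (hermiteL2 𝕜 k) g = 0) : g = 0 := by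
  have hg := Lp.memLp g
  have hInt : ∀ k, Integrable (fun y => g y * ((hermiteTilde k y : ℝ) : 𝕜)) (gammaInv n) :=
    fun k => hg.integrable_mul (memLp_hermiteTilde 𝕜 k)
  have hre : (fun y => RCLike.re (g y)) =ᵐ[gammaInv n] 0 := by
    refine ae_eq_zero_of_integral_mul_hermiteTilde hg.re fun k => ?_
    have h1 := congrArg RCLike.re (inner_hermiteL2 k g)
    rw [h k, ← integral_re (hInt k)] at h1
    simpa using h1.symm
  have him : (fun y => RCLike.im (g y)) =ᵐ[gammaInv n] 0 := by
    refine ae_eq_zero_of_integral_mul_hermiteTilde hg.im fun k => ?_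
    have h1 := congrArg RCLike.im (inner_hermiteL2 k g)
    rw [h k, ← integral_im (hInt k)] at h1
    simpa using h1.symm
  rw [Lp.eq_zero_iff_ae_eq_zero]
  filter_upwards [hre, him] with y h1 h2
  exact RCLike.ext (by simpa using h1) (by simpa using h2)

/-- The normalized functions form a Hilbert basis; the normalization enters twice, giving the factor
‖H̃_k‖⁻² in c_k. -/
theorem hasSum_coeff_smul_hermiteL2 (g : Lp 𝕜 2 (gammaInv n)) :
    HasSum (fun k => coeff g k • hermiteL2 𝕜 k) g := by
  have hsp : (Submodule.span 𝕜 (range (hermiteUnit (n := n) 𝕜)))ᗮ = ⊥ := by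
    rw [Submodule.eq_bot_iff]
    intro f hf
    refine eq_zero_of_inner_hermiteL2 fun k => ?_
    have h1 := (Submodule.mem_orthogonal _ _).1 hf (hermiteUnit 𝕜 k)
      (Submodule.subset_span ⟨k, rfl⟩)
    rw [hermiteUnit, inner_smul_left] at h1
    refine (mul_eq_zero.1 h1).resolve_left ?_
    simpa using hermiteL2_ne_zero k
  have h := (HilbertBasis.mkOfOrthogonalEqBot orthonormal_hermiteUnit hsp).hasSum_repr g
  convert! h using 2 with k
  rw [HilbertBasis.repr_apply_apply, HilbertBasis.coe_mkOfOrthogonalEqBot, hermiteUnit,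
    inner_smul_left, smul_smul, RCLike.conj_ofReal, coeff_eq_inner]
  congr 1
  push_cast
  ring

/-! ### The integral operator and its extensions -/

/-- The integral operator with the kernel `∫ t^(β-1) / Γ(β) e^{-t𝒜}(x, y) dt`. -/
def riesz (β : ℝ) (f : (E n) → 𝕜) (x : E n) : 𝕜 :=
  ∫ z, mehler (exp (-z.1)) x z.2 • f z.2 ∂((riemannLiouville β).prod (gammaInv n))

theorem enorm_mehler_smul (t : ℝ) (x y : E n) (a : 𝕜) :
    ‖mehler (exp (-t)) x y • a‖ₑ = mehlerE t x y * ‖a‖ₑ := by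
  rw [enorm_smul, mehlerE, Real.enorm_eq_ofReal (mehler_nonneg (exp_pos _).le _ _)]

theorem enorm_riesz_le (β : ℝ) (f : (E n) → 𝕜) (x : E n) :
    ‖riesz β f x‖ₑ ≤ potential β (fun y => ‖f y‖ₑ) x := by
  refine (enorm_integral_le_lintegral_enorm _).trans_eq ?_
  simp_rw [enorm_mehler_smul]
  rfl

theorem stronglyMeasurable_mehler_smul {f : (E n) → 𝕜} (hf : StronglyMeasurable f) :
    StronglyMeasurable fun a : (E n) × (ℝ × E n) => mehler (exp (-a.2.1)) a.1 a.2.2 • f a.2.2 := by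
  have h1 : Measurable fun a : (E n) × (ℝ × E n) => (exp (-a.2.1), a.1, a.2.2) := by fun_prop
  have h2 := (measurable_mehler (n := n)).comp h1
  exact h2.stronglyMeasurable.smul (hf.comp_measurable (by fun_prop))

theorem stronglyMeasurable_riesz (β : ℝ) {f : (E n) → 𝕜} (hf : StronglyMeasurable f) :
    StronglyMeasurable (riesz β f) :=
  StronglyMeasurable.integral_prod_right' (stronglyMeasurable_mehler_smul hf)

theorem integrable_mehler_smul {β : ℝ} {f : (E n) → 𝕜} (hf : StronglyMeasurable f) {x : E n}
    (hx : potential β (fun y => ‖f y‖ₑ) x < ∞) :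
    Integrable (fun z : ℝ × E n => mehler (exp (-z.1)) x z.2 • f z.2)
      ((riemannLiouville β).prod (gammaInv n)) := by
  refine ⟨((stronglyMeasurable_mehler_smul hf).comp_measurable
    (measurable_prodMk_left (x := x))).aestronglyMeasurable, ?_⟩
  rw [HasFiniteIntegral]
  simp_rw [enorm_mehler_smul]
  exact hx

theorem riesz_congr_ae (β : ℝ) {f g : (E n) → 𝕜} (h : f =ᵐ[gammaInv n] g) :
    riesz β f = riesz β g := by
  ext x
  refine integral_congr_ae ?_
  filter_upwards [Measure.quasiMeasurePreserving_snd.ae_eq_comp h] with z hz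
  simp only [Function.comp_apply] at hz
  rw [hz]

theorem riesz_add {β : ℝ} {f g : (E n) → 𝕜} (hf : StronglyMeasurable f)
    (hg : StronglyMeasurable g) {x : E n} (hfx : potential β (fun y => ‖f y‖ₑ) x < ∞)
    (hgx : potential β (fun y => ‖g y‖ₑ) x < ∞) :
    riesz β (f + g) x = riesz β f x + riesz β g x := by
  unfold riesz
  rw [← integral_add (integrable_mehler_smul hf hfx) (integrable_mehler_smul hg hgx)]
  simp only [Pi.add_apply, smul_add]

theorem riesz_smul (β : ℝ) (c : 𝕜) (f : (E n) → 𝕜) (x : E n) :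
    riesz β (c • f) x = c • riesz β f x := by
  unfold riesz
  rw [← integral_smul]
  simp only [Pi.smul_apply, smul_comm c]

/-- Finiteness of the potential permits Fubini, and the remaining integral of e^{-(|k|+n)t} gives
(|k|+n)^{-β}. -/
theorem riesz_hermiteTilde (hn : 0 < n) {β : ℝ} (hβ : 0 < β) (k : Fin n → ℕ) {x : E n}
    (hx : potential β (fun y => ‖((hermiteTilde k y : ℝ) : 𝕜)‖ₑ) x < ∞) :
    riesz β (fun y => ((hermiteTilde k y : ℝ) : 𝕜)) x =
      (((((((∑ i, k i : ℕ) : ℝ) + n) ^ β)⁻¹ : ℝ)) : 𝕜) * ((hermiteTilde k x : ℝ) : 𝕜) := by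
  have hm : StronglyMeasurable fun y : E n => ((hermiteTilde k y : ℝ) : 𝕜) :=
    (RCLike.continuous_ofReal.comp (continuous_hermiteTilde k)).stronglyMeasurable
  have hn' : (0 : ℝ) < n := by exact_mod_cast hn
  unfold riesz
  rw [integral_prod _ (integrable_mehler_smul hm hx)]
  have h : ∀ᵐ t ∂(riemannLiouville β),
      ∫ y, mehler (exp (-t)) x y • ((hermiteTilde k y : ℝ) : 𝕜) ∂(gammaInv n) =
        ((exp (-(((∑ i, k i : ℕ) : ℝ) + n) * t) * hermiteTilde k x : ℝ) : 𝕜) := by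
    filter_upwards [ae_pos_riemannLiouville β] with t ht
    have he : exp (-(((∑ i, k i : ℕ) : ℝ) + n) * t) = exp (-t) ^ ((∑ i, k i) + n) := by
      rw [← exp_nat_mul]; congr 1; push_cast; ring
    rw [he, ← integral_mehler_mul_hermiteTilde (exp_pos _) (exp_neg_lt_one ht), ← integral_ofReal]
    congr 1; ext y
    rw [RCLike.real_smul_eq_coe_mul]
    push_cast; rfl
  rw [integral_congr_ae h, integral_ofReal, integral_mul_const,
    integral_exp_riemannLiouville hβ (by positivity)]
  push_cast; rfl

theorem eLpNorm_potential_le (hn : 0 < n) {β : ℝ} (hβ : 0 < β) {p : ℝ≥0∞} (hp1 : 1 < p)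
    (hp : p < ∞) :
    ∃ C : ℝ≥0, ∀ f : (E n) → 𝕜, StronglyMeasurable f →
      eLpNorm (potential β fun y => ‖f y‖ₑ) p (gammaInv n) ≤ C * eLpNorm f p (gammaInv n) := by
  have hp0 : p ≠ 0 := (zero_lt_one.trans hp1).ne'
  have hpr : 1 < p.toReal := by
    rw [← ENNReal.toReal_one]; exact (ENNReal.toReal_lt_toReal (by simp) hp.ne).2 hp1
  obtain ⟨C, hC⟩ := exists_lintegral_potential_rpow_le hn hβ hpr
  refine ⟨C, fun f hf => ?_⟩
  have h := hC (fun y => ‖f y‖ₑ) hf.enorm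
  rw [eLpNorm_eq_lintegral_rpow_enorm_toReal hp0 hp.ne,
    eLpNorm_eq_lintegral_rpow_enorm_toReal hp0 hp.ne]
  simp only [enorm_eq_self]
  calc _ ≤ ((C : ℝ≥0∞) ^ p.toReal * ∫⁻ x, ‖f x‖ₑ ^ p.toReal ∂(gammaInv n)) ^ (1 / p.toReal) := by
        gcongr
    _ = _ := by
        rw [ENNReal.mul_rpow_of_nonneg _ _ (by positivity), ← ENNReal.rpow_mul, mul_one_div,
          div_self (by positivity), ENNReal.rpow_one]

theorem measurable_potential (β : ℝ) {F : (E n) → ℝ≥0∞} (hF : Measurable F) :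
    Measurable (potential β F) :=
  Measurable.lintegral_prod_right' (f := fun a : (E n) × (ℝ × E n) =>
    mehlerE a.2.1 a.1 a.2.2 * F a.2.2)
    ((measurable_mehlerE_comp (by fun_prop) (by fun_prop) (by fun_prop)).mul (by fun_prop))

theorem ae_potential_lt_top (hn : 0 < n) {β : ℝ} (hβ : 0 < β) {p : ℝ≥0∞} (hp1 : 1 < p)
    (hp : p < ∞) {f : (E n) → 𝕜} (hfm : StronglyMeasurable f) (hf : MemLp f p (gammaInv n)) :
    ∀ᵐ x ∂(gammaInv n), potential β (fun y => ‖f y‖ₑ) x < ∞ := by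
  have hp0 : p ≠ 0 := (zero_lt_one.trans hp1).ne'
  obtain ⟨C, hC⟩ := eLpNorm_potential_le (𝕜 := 𝕜) hn hβ hp1 hp
  have h := (hC f hfm).trans_lt (ENNReal.mul_lt_top ENNReal.coe_lt_top hf.2)
  rw [eLpNorm_lt_top_iff_lintegral_rpow_enorm_lt_top hp0 hp.ne] at h
  have hm := measurable_potential β hfm.enorm
  have h1 := ae_lt_top (by simp only [enorm_eq_self]; fun_prop) h.ne
  filter_upwards [h1] with x hx
  simp only [enorm_eq_self] at hx
  by_contra hcon
  rw [not_lt, top_le_iff] at hcon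
  rw [hcon, ENNReal.top_rpow_of_pos (ENNReal.toReal_pos hp0 hp.ne)] at hx
  exact lt_irrefl _ hx

/-- The infinity set lies in every superlevel set; apply the weak bound at the levels m + 1 and let
m grow. -/
theorem ae_potential_lt_top_one (hn : 0 < n) {β : ℝ} (hβ : 0 < β) {F : (E n) → ℝ≥0∞}
    (hF : Measurable F) (hfin : ∫⁻ y, F y ∂(gammaInv n) ≠ ∞) :
    ∀ᵐ x ∂(gammaInv n), potential β F x < ∞ := by
  obtain ⟨C, hC⟩ := exists_gammaInv_potential_le (n := n) hn hβ
  set I := ∫⁻ y, F y ∂(gammaInv n)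
  have h : ∀ m : ℕ, gammaInv n {x | ¬ potential β F x < ∞} ≤ C * I / ((m + 1 : ℕ) : ℝ≥0∞) := by
    intro m
    refine (measure_mono fun x hx => ?_).trans ((hC F hF ((m + 1 : ℕ) : ℝ≥0∞)
      (by simp) (by simp)).trans_eq ?_)
    · have hx : ¬ potential β F x < ∞ := hx
      rw [not_lt, top_le_iff] at hx
      change _ < potential β F x
      rw [hx]
      exact ENNReal.natCast_lt_top _
    · rw [div_eq_mul_inv, div_eq_mul_inv]; ring
  rw [ae_iff]
  have h0 := (ENNReal.tendsto_inv_nat_nhds_zero.comp (Filter.tendsto_add_atTop_nat 1))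
  have h1 := ENNReal.Tendsto.const_mul (a := C * I) h0
    (Or.inr (ENNReal.mul_ne_top ENNReal.coe_ne_top hfin))
  rw [mul_zero] at h1
  exact le_antisymm (ge_of_tendsto' h1 h) zero_le

theorem riesz_coeFn_add {β : ℝ} {p : ℝ≥0∞} (f g : Lp 𝕜 p (gammaInv n))
    (hf : ∀ᵐ x ∂(gammaInv n), potential β (fun y => ‖f y‖ₑ) x < ∞)
    (hg : ∀ᵐ x ∂(gammaInv n), potential β (fun y => ‖g y‖ₑ) x < ∞) :
    riesz β (f + g : Lp 𝕜 p (gammaInv n)) =ᵐ[gammaInv n] riesz β f + riesz β g := by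
  rw [riesz_congr_ae β (Lp.coeFn_add f g)]
  filter_upwards [hf, hg] with x h1 h2
  exact riesz_add (Lp.stronglyMeasurable f) (Lp.stronglyMeasurable g) h1 h2

theorem riesz_coeFn_smul (β : ℝ) {p : ℝ≥0∞} (c : 𝕜) (f : Lp 𝕜 p (gammaInv n)) :
    riesz β (c • f : Lp 𝕜 p (gammaInv n)) = c • riesz β f := by
  rw [riesz_congr_ae β (Lp.coeFn_smul c f)]
  exact funext (riesz_smul β c f)

theorem exists_rieszCLM (hn : 0 < n) {β : ℝ} (hβ : 0 < β) (p : ℝ≥0∞) [Fact (1 ≤ p)] (hp1 : 1 < p)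
    (hp : p < ∞) :
    ∃ T : Lp 𝕜 p (gammaInv n) →L[𝕜] Lp 𝕜 p (gammaInv n),
      ∀ f : Lp 𝕜 p (gammaInv n), T f =ᵐ[gammaInv n] riesz β f := by
  obtain ⟨C, hC⟩ := eLpNorm_potential_le (𝕜 := 𝕜) hn hβ hp1 hp
  have hle : ∀ f : Lp 𝕜 p (gammaInv n), eLpNorm (riesz β f) p (gammaInv n) ≤
      C * eLpNorm f p (gammaInv n) := fun f =>
    (eLpNorm_mono_enorm fun x => by simpa using enorm_riesz_le β f x).trans
      (hC f (Lp.stronglyMeasurable f))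
  have hmem : ∀ f : Lp 𝕜 p (gammaInv n), MemLp (riesz β f) p (gammaInv n) := fun f =>
    ⟨(stronglyMeasurable_riesz β (Lp.stronglyMeasurable f)).aestronglyMeasurable,
      (hle f).trans_lt (ENNReal.mul_lt_top ENNReal.coe_lt_top (Lp.eLpNorm_lt_top f))⟩
  have hfin : ∀ f : Lp 𝕜 p (gammaInv n),
      ∀ᵐ x ∂(gammaInv n), potential β (fun y => ‖f y‖ₑ) x < ∞ := fun f =>
    ae_potential_lt_top hn hβ hp1 hp (Lp.stronglyMeasurable f) (Lp.memLp f)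
  let L : Lp 𝕜 p (gammaInv n) →ₗ[𝕜] Lp 𝕜 p (gammaInv n) :=
    { toFun := fun f => (hmem f).toLp _
      map_add' := fun f g => by
        rw [← MemLp.toLp_add, MemLp.toLp_eq_toLp_iff]
        exact riesz_coeFn_add f g (hfin f) (hfin g)
      map_smul' := fun c f => by
        rw [RingHom.id_apply, ← MemLp.toLp_const_smul, MemLp.toLp_eq_toLp_iff, riesz_coeFn_smul] }
  refine ⟨L.mkContinuous C fun f => ?_, fun f => (hmem f).coeFn_toLp⟩
  change ‖(hmem f).toLp _‖ ≤ _
  rw [Lp.norm_toLp, Lp.norm_def, ← ENNReal.coe_toReal, ← ENNReal.toReal_mul]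
  exact ENNReal.toReal_mono (ENNReal.mul_ne_top ENNReal.coe_ne_top (Lp.eLpNorm_ne_top f)) (hle f)

/-- Only a weak bound is available at the endpoint, so the target consists of almost-everywhere
classes. -/
theorem exists_rieszLinearMap (hn : 0 < n) {β : ℝ} (hβ : 0 < β) :
    ∃ T : Lp 𝕜 1 (gammaInv n) →ₗ[𝕜] ((E n) →ₘ[gammaInv n] 𝕜),
      ∀ f : Lp 𝕜 1 (gammaInv n), T f =ᵐ[gammaInv n] riesz β f := by
  have hfin : ∀ f : Lp 𝕜 1 (gammaInv n),
      ∀ᵐ x ∂(gammaInv n), potential β (fun y => ‖f y‖ₑ) x < ∞ := fun f => by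
    refine ae_potential_lt_top_one hn hβ (Lp.stronglyMeasurable f).enorm ?_
    rw [← eLpNorm_one_eq_lintegral_enorm]
    exact Lp.eLpNorm_ne_top f
  have hm : ∀ f : Lp 𝕜 1 (gammaInv n), AEStronglyMeasurable (riesz β f) (gammaInv n) := fun f =>
    (stronglyMeasurable_riesz β (Lp.stronglyMeasurable f)).aestronglyMeasurable
  refine ⟨{ toFun := fun f => AEEqFun.mk (riesz β f) (hm f)
            map_add' := fun f g => ?_
            map_smul' := fun c f => ?_ }, fun f => AEEqFun.coeFn_mk _ (hm f)⟩
  · rw [AEEqFun.mk_add_mk, AEEqFun.mk_eq_mk]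
    exact riesz_coeFn_add f g (hfin f) (hfin g)
  · rw [RingHom.id_apply, AEEqFun.smul_mk, AEEqFun.mk_eq_mk, riesz_coeFn_smul]

theorem exists_gammaInv_riesz_le (hn : 0 < n) {β : ℝ} (hβ : 0 < β) :
    ∃ C : ℝ≥0, ∀ (f : Lp 𝕜 1 (gammaInv n)) (s : ℝ), 0 < s →
      gammaInv n {x | s < ‖riesz β f x‖} ≤ ENNReal.ofReal (C * ‖f‖ / s) := by
  obtain ⟨C, hC⟩ := exists_gammaInv_potential_le (n := n) hn hβ
  refine ⟨C, fun f s hs => ?_⟩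
  refine (measure_mono fun x hx => ?_).trans
    ((hC (fun y => ‖f y‖ₑ) (Lp.stronglyMeasurable f).enorm (ENNReal.ofReal s)
      (by simpa using hs) (by simp)).trans_eq ?_)
  · have hx : s < ‖riesz β f x‖ := hx
    refine lt_of_lt_of_le ?_ (enorm_riesz_le β f x)
    rw [← ofReal_norm, ENNReal.ofReal_lt_ofReal_iff (hs.trans hx)]
    exact hx
  · rw [← eLpNorm_one_eq_lintegral_enorm, ← Lp.enorm_def, ← ofReal_norm, mul_div_right_comm,
      ENNReal.ofReal_mul (by positivity), ENNReal.ofReal_div_of_pos hs, ENNReal.ofReal_coe_nnreal]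

theorem hasSum_negPowTerm (hn : 0 < n) {β : ℝ} (hβ : 0 < β)
    {T : Lp 𝕜 2 (gammaInv n) →L[𝕜] Lp 𝕜 2 (gammaInv n)}
    (hT : ∀ f : Lp 𝕜 2 (gammaInv n), T f =ᵐ[gammaInv n] riesz β f) (g : Lp 𝕜 2 (gammaInv n)) :
    HasSum (negPowTerm β g) (T g) := by
  have heig : ∀ k : Fin n → ℕ, T (hermiteL2 𝕜 k) =
      (((((((∑ i, k i : ℕ) : ℝ) + n) ^ β)⁻¹ : ℝ)) : 𝕜) • hermiteL2 𝕜 k := by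
    intro k
    have hm : StronglyMeasurable fun y : E n => ((hermiteTilde k y : ℝ) : 𝕜) :=
      (RCLike.continuous_ofReal.comp (continuous_hermiteTilde k)).stronglyMeasurable
    refine Lp.ext ?_
    have h1 := hT (hermiteL2 𝕜 k)
    rw [riesz_congr_ae β (coeFn_hermiteL2 k)] at h1
    filter_upwards [h1, Lp.coeFn_smul (((((((∑ i, k i : ℕ) : ℝ) + n) ^ β)⁻¹ : ℝ)) : 𝕜)
      (hermiteL2 𝕜 k), coeFn_hermiteL2 (𝕜 := 𝕜) k,
      ae_potential_lt_top hn hβ ENNReal.one_lt_two ENNReal.ofNat_lt_top hm (memLp_hermiteTilde 𝕜 k)]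
      with x h1 h2 h3 h4
    rw [h1, h2, Pi.smul_apply, h3, smul_eq_mul, riesz_hermiteTilde hn hβ k h4]
  -- Continuity of T on L² transports unconditional convergence of the expansion to the series of
  -- images.
  have h := (hasSum_coeff_smul_hermiteL2 g).mapL T
  convert! h using 2 with k
  rw [map_smul, heig, smul_smul, negPowTerm, RCLike.ofReal_inv, div_eq_mul_inv]

end

end InverseGauss

theorem proposition2p1 {𝕜 : Type*} [RCLike 𝕜] (n : ℕ) (hn : 0 < n) (β : ℝ) (hβ : 0 < β) :
    -- the series that defines `𝒜^{-β} f` converges in `L²(γ₋₁)`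
    (∀ f : Lp 𝕜 2 (InverseGauss.gammaInv n), Summable (InverseGauss.negPowTerm β f)) ∧
    -- `𝒜^{-β}` extends from `L^p ∩ L²` to a bounded linear operator on `L^p`, `1 < p < ∞`
    (∀ (p : ℝ≥0∞) [Fact (1 ≤ p)], 1 < p → p < ∞ →
      ∃ T : Lp 𝕜 p (InverseGauss.gammaInv n) →L[𝕜] Lp 𝕜 p (InverseGauss.gammaInv n),
        ∀ (f : Lp 𝕜 p (InverseGauss.gammaInv n)) (g : Lp 𝕜 2 (InverseGauss.gammaInv n)),
          f =ᵐ[InverseGauss.gammaInv n] g →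
            T f =ᵐ[InverseGauss.gammaInv n] InverseGauss.negPow β g) ∧
    -- `𝒜^{-β}` extends from `L¹ ∩ L²` to a bounded linear operator from `L¹` into `L^{1,∞}`
    (∃ T : Lp 𝕜 1 (InverseGauss.gammaInv n) →ₗ[𝕜]
        (EuclideanSpace ℝ (Fin n) →ₘ[InverseGauss.gammaInv n] 𝕜),
      (∃ C : ℝ≥0, ∀ (f : Lp 𝕜 1 (InverseGauss.gammaInv n)) (s : ℝ), 0 < s →
        InverseGauss.gammaInv n {x | s < ‖T f x‖} ≤ ENNReal.ofReal (C * ‖f‖ / s)) ∧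
      ∀ (f : Lp 𝕜 1 (InverseGauss.gammaInv n)) (g : Lp 𝕜 2 (InverseGauss.gammaInv n)),
        f =ᵐ[InverseGauss.gammaInv n] g →
          T f =ᵐ[InverseGauss.gammaInv n] InverseGauss.negPow β g) := by
  -- The exponent 2 identifies `riesz` with the series; every extension then agrees with it through
  -- the common pointwise formula.
  obtain ⟨T₂, hT₂⟩ := InverseGauss.exists_rieszCLM (𝕜 := 𝕜) hn hβ 2 ENNReal.one_lt_two
    ENNReal.ofNat_lt_top
  have hsum := InverseGauss.hasSum_negPowTerm hn hβ hT₂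
  have hneg : ∀ g : Lp 𝕜 2 (InverseGauss.gammaInv n),
      InverseGauss.riesz β g =ᵐ[InverseGauss.gammaInv n] InverseGauss.negPow β g := fun g => by
    rw [InverseGauss.negPow, (hsum g).tsum_eq]
    exact (hT₂ g).symm
  refine ⟨fun f => (hsum f).summable, fun p _ hp1 hp => ?_, ?_⟩
  · obtain ⟨T, hT⟩ := InverseGauss.exists_rieszCLM (𝕜 := 𝕜) hn hβ p hp1 hp
    refine ⟨T, fun f g hfg => (hT f).trans ?_⟩
    rw [InverseGauss.riesz_congr_ae β hfg]
    exact hneg g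
  · obtain ⟨T, hT⟩ := InverseGauss.exists_rieszLinearMap (𝕜 := 𝕜) hn hβ
    obtain ⟨C, hC⟩ := InverseGauss.exists_gammaInv_riesz_le (𝕜 := 𝕜) hn hβ
    refine ⟨T, ⟨C, fun f s hs => ?_⟩, fun f g hfg => (hT f).trans ?_⟩
    · refine (measure_congr ?_).trans_le (hC f s hs)
      filter_upwards [hT f] with x hx
      change (s < ‖T f x‖) = (s < ‖InverseGauss.riesz β f x‖)
      rw [hx]
    · rw [InverseGauss.riesz_congr_ae β hfg]
      exact hneg g
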